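/- Let $(X,\Phi,X^\vee,\Phi^\vee)$ be a reduced root datum ($X$ a lattice of finite rank, $\Phi$ finite) with a fixed base of simple roots and Weyl group $W$; write $s_\alpha\in W$ for the reflection in a root $\alpha$, $l$ for the length function with respect to the simple reflections, and $\leqslant$ for the Bruhat order. Let $K$ be the field of rational functions in an indeterminate $q$ and in $\mathbf z\in \hat T(\mathbb C)=\operatorname{Hom}(X,\mathbb C^\times)$, write $\mathbf z^\lambda\in K$ for the character $\lambda\in X$, and let $f\mapsto\overline f$ be the automorphism of $K$ with $q\mapsto q^{-1}$ that fixes $\mathbf z$. Let $W$ act on $\mathbf z$ by $(w\mathbf z)^\lambda=\mathbf z^{w^{-1}\lambda}$. Let $\mathcal H$ be the Iwahori Hecke algebra of $W$ over $K$, with basis $(T_w)_{w\in W}$, so that for a simple reflection $s$ one has $T_sT_w=T_{sw}$ if $l(sw)>l(w)$ and $T_sT_w=(q-1)T_w+qT_{sw}$ if $l(sw)<l(w)$. For a simple root $\alpha$ and $s=s_\alpha$ put $$\mu_{\mathbf z}(s)=q^{-1}T_s+(1-q^{-1})\frac{\mathbf z^\alpha}{1-\mathbf z^\alpha},$$ and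 extend this to $\mu_{\mathbf z}(w)$, $w\in W$, along reduced words by the rule $\mu_{\mathbf z}(1)=1$ and $\mu_{\mathbf z}(w_1w_2)=\mu_{\mathbf z}(w_2)\,\mu_{w_2\mathbf z}(w_1)$ whenever $l(w_1w_2)=l(w_1)+l(w_2)$. Define $r_{u,v}=r_{u,v}(\mathbf z)\in K$ for $u,v\in W$ by $$\mu_{\mathbf z}(v)=\sum_{u\in W}q^{-l(u)}\,\overline{r_{u,v}}\,T_{u^{-1}}.$$ Then the elements $\mu_{\mathbf z}(w)$ are well defined (the rule above holds, independently of the chosen reduced words), the $r_{u,v}$ are well defined by the displayed expansion, and the matrix $(r_{u,v})_{u,v\in W}$ has a two-sided inverse $(r'_{u,v})_{u,v\in W}$. Moreover, let $\alpha$ be a simple root, $s=s_\alpha$, and let $u,v\in W$ with $su>u$. If $v<sv$, then $$r'_{u,v}=r'_{su,sv}+\frac{q-1}{1-\mathbf z^{u^{-1}\alpha}}\,r'_{su,v}.$$ If $v>sv$, then $$r'_{u,v}=\frac{(q-1)\,\mathbf z^{u^{-1}\alpha}}{1-\mathbf z^{u^{-1}\alpha}}\,r'_{su,v}+q\,r'_{su,sv}.$$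 -/

import Mathlib

namespace Casselman

open RootPairing

/-! ### The field of rational functions in an indeterminate `q` and on the torus -/

section Coefficients

variable (X : Type*) [AddCommGroup X]

/-- The ring `ℂ[q, q⁻¹][X]` of Laurent polynomials in `q` with coefficients in the coordinate ring
`ℂ[X]` of the torus `Hom(X, ℂˣ)` with character lattice `X`. The monomial `(n, lam)` is
`q ^ n * z ^ lam`. -/
abbrev CoordRing := AddMonoidAlgebra ℂ (ℤ × X)

/-- The field `ℂ(q)(T)` of rational functions in `q` and in `z ∈ T = Hom(X, ℂˣ)`. -/
abbrev FunField := FractionRing (CoordRing X)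

instance [Module.Free ℤ X] : TwoUniqueSums X :=
  TwoUniqueSums.of_injective_addHom
    (Module.Free.chooseBasis ℤ X).repr.toAddEquiv.toAddHom
    (Module.Free.chooseBasis ℤ X).repr.injective inferInstance

variable {X}

/-- The indeterminate `q`. -/
noncomputable def qv : FunField X :=
  algebraMap (CoordRing X) (FunField X) (AddMonoidAlgebra.single ((1 : ℤ), (0 : X)) 1)

/-- The function `z ↦ z ^ lam` for a character `lam` of the torus. -/
noncomputable def zpow (lam : X) : FunField X :=
  algebraMap (CoordRing X) (FunField X) (AddMonoidAlgebra.single ((0 : ℤ), lam) 1)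

/-- The involution `f ↦ f̄` of the function field: `q ↦ q⁻¹`, while `z` is unchanged. -/
noncomputable def bar : FunField X ≃+* FunField X :=
  IsFractionRing.ringEquivOfRingEquiv
    (AddMonoidAlgebra.mapDomainRingEquiv ℂ
      (AddEquiv.prodCongr (AddEquiv.neg ℤ) (AddEquiv.refl X)) : CoordRing X ≃+* CoordRing X)

lemma bar_qv [Module.Free ℤ X] : bar (qv : FunField X) = qv⁻¹ := by
  have h : bar (qv : FunField X) * qv = 1 := by
    have h0 : AddEquiv.prodCongr (AddEquiv.neg ℤ) (AddEquiv.refl X) (1, 0) + (1, 0) = 0 := by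
      ext <;> simp [AddEquiv.prodCongr]
    simp [bar, qv, ← map_mul, AddMonoidAlgebra.single_mul_single, h0, AddMonoidAlgebra.one_def]
  exact eq_inv_of_mul_eq_one_left h

lemma bar_zpow (lam : X) : bar (zpow lam) = zpow lam := by
  have h0 : AddEquiv.prodCongr (AddEquiv.neg ℤ) (AddEquiv.refl X) (0, lam) = (0, lam) := by
    ext <;> simp [AddEquiv.prodCongr]
  simp [bar, zpow, h0]

end Coefficients

/-! ### The Weyl group: length and Bruhat order -/

section Weyl

variable {ι X Y : Type*} [AddCommGroup X] [AddCommGroup Y] {P : RootDatum ι X Y}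

instance [Finite ι] : Finite P.weylGroup := by
  have := Fintype.ofFinite ι
  refine Finite.of_injective P.weylGroupToPerm ((injective_iff_map_eq_one _).2 fun w hw ↦ ?_)
  have hroot (i : ι) : w • P.root i = P.root i := by
    rw [weylGroup_apply_root, hw]; rfl
  have hspan : ∀ g : Aut P, g ∈ P.weylGroup → ∀ x : X, g • x - x ∈ P.rootSpan ℤ := by
    intro g hg
    induction hg using weylGroup.induction with
    | mem i =>
      intro x
      rw [Equiv.reflection_smul, reflection_apply, sub_sub_cancel_left]
      exact neg_mem (Submodule.smul_mem _ _ (Submodule.subset_span ⟨i, rfl⟩))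
    | one => simp
    | mul g h _ _ hg hh =>
      intro x
      have := add_mem (hg (h • x)) (hh x)
      rwa [sub_add_sub_cancel, ← mul_smul] at this
  have hform : ∀ g : Aut P, g ∈ P.weylGroup → ∀ x y : X,
      P.RootForm (g • x) (g • y) = P.RootForm x y := by
    intro g hg
    induction hg using weylGroup.induction with
    | mem i => intro x y; simp
    | one => simp
    | mul g h _ _ hg hh => intro x y; rw [mul_smul, mul_smul, hg, hh]
  have hfix (x : X) : w.1 • x = x := by
    rw [← sub_eq_zero]
    have hd := hspan w.1 w.2 x
    refine P.eq_zero_of_mem_rootSpan_of_rootForm_self_eq_zero hd ?_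
    have key : ∀ y ∈ P.rootSpan ℤ, P.RootForm (w.1 • x - x) y = 0 := by
      intro y hy
      induction hy using Submodule.span_induction with
      | mem y hy =>
        obtain ⟨i, rfl⟩ := hy
        have h1 := hform w.1 w.2 x (P.root i)
        rw [show w.1 • P.root i = P.root i from hroot i] at h1
        rw [map_sub, LinearMap.sub_apply, h1, sub_self]
      | zero => simp
      | add y z _ _ hy hz => rw [map_add, hy, hz, add_zero]
      | smul a y _ hy => rw [map_smul, hy, smul_zero]
    exact key _ hd
  apply Subtype.ext
  apply Equiv.weightHom_injective P
  ext x
  exact hfix x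

noncomputable instance [Finite ι] : Fintype P.weylGroup := Fintype.ofFinite _

noncomputable instance : DecidableEq P.weylGroup := Classical.decEq _

variable (b : P.Base)

/-- The simple reflection `s_α` attached to a simple root `α` of the base `b`. -/
noncomputable def simpleRefl (i : b.support) : P.weylGroup := weylGroup.ofIdx P i

/-- The product in the Weyl group of a word in the simple reflections. -/
noncomputable def wordProd (ω : List b.support) : P.weylGroup := (ω.map (simpleRefl b)).prod

lemma exists_wordProd [Finite ι] [P.IsReduced] (w : P.weylGroup) : ∃ ω : List b.support, wordProd b ω = w := by
  have hrefl (k : ι) : ∃ ω : List b.support, wordProd b ω = weylGroup.ofIdx P k := by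
    have hconj (i j : ι) : weylGroup.ofIdx P (P.reflectionPerm j i) =
        weylGroup.ofIdx P j * weylGroup.ofIdx P i * weylGroup.ofIdx P j := by
      apply Subtype.ext
      apply Equiv.weightHom_injective P
      ext x
      exact LinearEquiv.congr_fun (P.reflection_reflectionPerm (i := i) (j := j)) x
    induction k using b.induction_reflect with
    | h₀ i ih =>
      obtain ⟨ω, hω⟩ := ih
      refine ⟨ω ++ ω ++ ω, ?_⟩
      rw [hconj, ← hω]
      simp [wordProd, mul_assoc]
    | h₁ i hi => exact ⟨[⟨i, hi⟩], by simp [wordProd, simpleRefl]⟩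
    | h₂ i j ih hj =>
      obtain ⟨ω, hω⟩ := ih
      refine ⟨⟨j, hj⟩ :: (ω ++ [⟨j, hj⟩]), ?_⟩
      rw [hconj, ← hω]
      simp [wordProd, simpleRefl, mul_assoc]
  obtain ⟨w, hw⟩ := w
  induction hw using weylGroup.induction with
  | mem i => exact hrefl i
  | one => exact ⟨[], rfl⟩
  | mul x y hx hy ihx ihy =>
    obtain ⟨ω, hω⟩ := ihx
    obtain ⟨ω', hω'⟩ := ihy
    refine ⟨ω ++ ω', ?_⟩
    rw [wordProd, List.map_append, List.prod_append, ← wordProd, ← wordProd, hω, hω']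
    rfl

lemma exists_length [Finite ι] [P.IsReduced] (w : P.weylGroup) :
    ∃ n, ∃ ω : List b.support, ω.length = n ∧ wordProd b ω = w := by
  obtain ⟨ω, hω⟩ := exists_wordProd b w
  exact ⟨_, ω, rfl, hω⟩

variable [Finite ι] [P.IsReduced]

open scoped Classical in
/-- The length `l(w)`: the least length of a word in the simple reflections with product `w`. -/
noncomputable def len (w : P.weylGroup) : ℕ := Nat.find (exists_length b w)

open scoped Classical in
lemma exists_reduced (w : P.weylGroup) :
    ∃ ω : List b.support, ω.length = len b w ∧ wordProd b ω = w :=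
  Nat.find_spec (exists_length b w)

open scoped Classical in
lemma len_wordProd_le (ω : List b.support) : len b (wordProd b ω) ≤ ω.length :=
  Nat.find_min' (exists_length b _) ⟨ω, rfl, rfl⟩

/-- A chosen reduced word of `w`. -/
noncomputable def redWord (w : P.weylGroup) : List b.support := (exists_reduced b w).choose

/-- The Bruhat order `u ≤ v`: one can pass from `u` to `v` by successive multiplications by
reflections (in arbitrary roots), each of which increases the length. -/
def BruhatLE (u v : P.weylGroup) : Prop :=
  Relation.ReflTransGen
    (fun x y ↦ (∃ k : ι, y = x * weylGroup.ofIdx P k) ∧ len b x < len b y) u v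

/-- The strict Bruhat order `u < v`. -/
def BruhatLT (u v : P.weylGroup) : Prop := BruhatLE b u v ∧ u ≠ v

end Weyl

/-! ### The Iwahori Hecke algebra and the elements `μ_z(w)` -/

section Hecke

variable {ι X Y : Type*} [Finite ι] [AddCommGroup X] [AddCommGroup Y] {P : RootDatum ι X Y}
  [P.IsReduced] (b : P.Base)

/-- Left multiplication by `T_s` on the free module with basis `(T_w)`, the basis vector `T_w` being
`Finsupp.single w 1`: `T_s T_w = T_{sw}` if `l(sw) > l(w)`, and
`T_s T_w = (q - 1) T_w + q T_{sw}` otherwise. -/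
noncomputable def heckeOp (i : b.support) :
    Module.End (FunField X) (P.weylGroup →₀ FunField X) :=
  Finsupp.linearCombination (FunField X) fun w ↦
    if len b w < len b (simpleRefl b i * w) then Finsupp.single (simpleRefl b i * w) 1
    else Finsupp.single w (qv - 1) + Finsupp.single (simpleRefl b i * w) qv

/-- The Iwahori Hecke algebra of `W` over the function field, realised through its (faithful) left
regular representation: the algebra generated by the left multiplications by the `T_s`. -/
noncomputable def HeckeAlg : Subalgebra (FunField X) (Module.End (FunField X)
    (P.weylGroup →₀ FunField X)) :=
  Algebra.adjoin (FunField X) (Set.range (heckeOp b))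

/-- The generator `T_s` of the Hecke algebra. -/
noncomputable def Tsimple (i : b.support) : HeckeAlg b :=
  ⟨heckeOp b i, Algebra.subset_adjoin ⟨i, rfl⟩⟩

/-- The element `T_w = T_{s₁} ⋯ T_{sₖ}`, for a reduced expression `w = s₁ ⋯ sₖ`. -/
noncomputable def T (w : P.weylGroup) : HeckeAlg b := ((redWord b w).map (Tsimple b)).prod

/-- The coefficient of `T_w` in an element `h = ∑ c_w T_w` of the Hecke algebra, read off from
`h T_1 = ∑ c_w T_w` in the regular representation. -/
noncomputable def heckeCoeff (h : HeckeAlg b) (w : P.weylGroup) : FunField X :=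
  (h : Module.End (FunField X) (P.weylGroup →₀ FunField X)) (Finsupp.single 1 1) w

lemma heckeOp_word (ω : List b.support) (h : len b (wordProd b ω) = ω.length) :
    ((ω.map (heckeOp b)).prod : Module.End (FunField X) (P.weylGroup →₀ FunField X))
      (Finsupp.single 1 1) = Finsupp.single (wordProd b ω) 1 := by
  induction ω with
  | nil => simp [wordProd]
  | cons i ω ih =>
    have hcons : wordProd b (i :: ω) = simpleRefl b i * wordProd b ω := by simp [wordProd]
    obtain ⟨ω', hl, hp⟩ := exists_reduced b (wordProd b ω)
    have h1 : len b (wordProd b (i :: ω)) ≤ len b (wordProd b ω) + 1 := by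
      have := len_wordProd_le b (i :: ω')
      rwa [show wordProd b (i :: ω') = wordProd b (i :: ω) by
        rw [hcons, ← hp]; simp [wordProd], List.length_cons, hl] at this
    have h2 := len_wordProd_le b ω
    rw [List.length_cons] at h
    have h3 : len b (wordProd b ω) < len b (simpleRefl b i * wordProd b ω) := by
      rw [← hcons]; omega
    rw [List.map_cons, List.prod_cons, Module.End.mul_apply, ih (by omega), heckeOp,
      Finsupp.linearCombination_single, one_smul, if_pos h3, hcons]

/-- The functions `heckeCoeff` are the coordinates dual to the `T_w`; in particular the `T_w` are
linearly independent. -/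
lemma heckeCoeff_T (w x : P.weylGroup) : heckeCoeff b (T b w) x = if w = x then 1 else 0 := by
  obtain ⟨hl, hp⟩ := (exists_reduced b w).choose_spec
  have h : ((T b w : HeckeAlg b) : Module.End (FunField X) (P.weylGroup →₀ FunField X)) =
      ((redWord b w).map (heckeOp b)).prod := by
    rw [T, ← Subalgebra.coe_val, map_list_prod, List.map_map]
    rfl
  have h' := heckeOp_word b (redWord b w) (by rw [redWord, hp, hl])
  rw [heckeCoeff, h, h', redWord, hp, Finsupp.single_apply]

variable [Module.Free ℤ X]

/-- The element `μ_{xz}(s_α) = q⁻¹ T_s + (1 - q⁻¹) (xz)^α / (1 - (xz)^α)` for a simple root `α`,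
where `x` is in the Weyl group and `(xz)^α = z^{x⁻¹ α}`. -/
noncomputable def muSimple (x : P.weylGroup) (i : b.support) : HeckeAlg b :=
  (qv : FunField X)⁻¹ • Tsimple b i +
    algebraMap (FunField X) (HeckeAlg b)
      ((1 - qv⁻¹) * (zpow (x⁻¹ • P.root i) / (1 - zpow (x⁻¹ • P.root i))))

/-- The element `μ_{xz}(s w) = μ_{xz}(w) μ_{wxz}(s)` computed along a word `s w`. -/
noncomputable def muWord (x : P.weylGroup) : List b.support → HeckeAlg b
  | [] => 1
  | i :: ω => muWord x ω * muSimple b (wordProd b ω * x) i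

/-- The element `μ_{xz}(w)` of the Hecke algebra, computed along a reduced word of `w`
(the result does not depend on the word). In particular `mu b 1 w` is `μ_z(w)`. -/
noncomputable def mu (x w : P.weylGroup) : HeckeAlg b := muWord b x (redWord b w)

/-- The matrix `(r_{u,v})`, defined by `μ_z(v) = ∑ u, q^{-l(u)} \bar{r_{u,v}} T_{u⁻¹}`. -/
noncomputable def r : Matrix P.weylGroup P.weylGroup (FunField X) :=
  Matrix.of fun u v ↦ bar (qv ^ len b u * heckeCoeff b (mu b 1 v) u⁻¹)

/-- The matrix `(r'_{u,v})` inverse to `(r_{u,v})`. -/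
noncomputable def rInv : Matrix P.weylGroup P.weylGroup (FunField X) := (r b)⁻¹

end Hecke

end Casselman

/-! Write `c(β) = z^β / (1 - z^β)`, which is `cayley`. The recursion is the matrix form of right
multiplication by `T_s` in two bases of the Hecke algebra. On the one hand `μ_z(w) T_s = -(q-1)
c(w⁻¹α) μ_z(w) + c' μ_z(sw)`, where `c' = q` when `sw > w` (`mu_mul_Tsimple`): for an ascent this is
the definition of `μ_z(sw)` solved for `μ_z(w) T_s`, and for a descent it follows from the quadratic
relation. On the other hand `T_s` acts by the standard rule on `q^{-l(v)} T_{v⁻¹} = ∑_w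
bar(r'_{w,v}) μ_z(w)`. Comparing the coefficients of `μ_z(su)` (`muCoeff_normT_mul_Tsimple`) and
applying the bar involution gives both cases.

The expansion in the `T_w` rests on commuting left and right multiplications: an element of the
Hecke algebra is determined by its value on `T_1` (`heckeAlg_ext`). The matrix `r` is invertible
because `μ_z(w)` is `q^{-l(w)} T_{w⁻¹}` plus shorter terms, so that `r` is unitriangular for the
length (`det_r`).

The cocycle rule needs independence of the reduced word (`muWord_eq_of_wordProd_eq`). Two reduced
words of one element with different first letters `i`, `j` can both be changed, by induction, into
words starting with the longest element of the subgroup generated by `s_i`, `s_j`. This leaves the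
Yang–Baxter equations for A₁ × A₁, A₂, B₂ and G₂. After the braid and quadratic relations are
applied, they become rational identities among the `c(β)` for the positive roots `β` of rank two. -/

namespace Casselman

open RootPairing

/-! ### Action of simple reflections on roots, and conjugation of reflections. -/

section RootsAndLength

variable {ι X Y : Type*} [AddCommGroup X] [AddCommGroup Y] {P : RootDatum ι X Y} (b : P.Base)

/-- The cone of nonnegative integral combinations of the simple roots. -/
def posCone : AddSubmonoid X := AddSubmonoid.closure (P.root '' b.support)

lemma simpleRefl_smul (i : b.support) (x : X) :
    simpleRefl b i • x = x - P.coroot' i x • P.root i := by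
  rw [simpleRefl, weylGroup.ofIdx_smul, Equiv.reflection_smul, reflection_apply]

lemma simpleRefl_smul_self (i : b.support) :
    simpleRefl b i • P.root i = -P.root i := by
  rw [simpleRefl, weylGroup.ofIdx_smul, Equiv.reflection_smul, reflection_apply_self]

lemma simpleRefl_smul_root (i : b.support) (j : ι) :
    simpleRefl b i • P.root j = P.root j - P.pairing j i • P.root i := by
  rw [simpleRefl_smul, root_coroot'_eq_pairing]

lemma simpleRefl_mul_self (i : b.support) : simpleRefl b i * simpleRefl b i = 1 := by
  apply Subtype.ext
  change Equiv.reflection P i * Equiv.reflection P i = 1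
  nth_rewrite 1 [← Equiv.reflection_inv]
  exact inv_mul_cancel _

lemma simpleRefl_inv (i : b.support) : (simpleRefl b i)⁻¹ = simpleRefl b i :=
  inv_eq_of_mul_eq_one_left (simpleRefl_mul_self b i)

@[simp] lemma simpleRefl_mul_cancel_left (i : b.support) (w : P.weylGroup) :
    simpleRefl b i * (simpleRefl b i * w) = w := by
  rw [← mul_assoc, simpleRefl_mul_self, one_mul]

@[simp] lemma simpleRefl_mul_cancel_right (i : b.support) (w : P.weylGroup) :
    w * simpleRefl b i * simpleRefl b i = w := by
  rw [mul_assoc, simpleRefl_mul_self, mul_one]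

lemma weyl_ext {v w : P.weylGroup} (h : ∀ x : X, v • x = w • x) : v = w := by
  apply Subtype.ext
  apply Equiv.weightHom_injective P
  ext x
  exact h x

/-- Conjugating a simple reflection: if `w α_j = ± α_i` then `s_i w = w s_j`. -/
lemma simpleRefl_mul_eq_of_smul_root {w : P.weylGroup} {i j : b.support}
    (h : w • P.root j = P.root i ∨ w • P.root j = -P.root i) :
    simpleRefl b i * w = w * simpleRefl b j := by
  have hperm : ∀ k : ι, w • P.root j = P.root k →
      weylGroup.ofIdx P k * w = w * simpleRefl b j := by
    intro k hk
    obtain ⟨g, hg⟩ := w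
    -- Arbitrary roots are allowed, since the intermediate images in the induction on generators
    -- need not be simple.
    have key : ∀ g : Aut P, g ∈ P.weylGroup → ∀ j k : ι, g • P.root j = P.root k →
        Equiv.reflection P k * g = g * Equiv.reflection P j := by
      intro g hg
      induction hg using weylGroup.induction with
      | mem i =>
        intro j k hk
        have hk' : k = P.reflectionPerm i j := by
          apply P.root.injective
          rw [← hk, Equiv.reflection_smul, root_reflectionPerm]
        subst hk'
        apply Equiv.weightHom_injective P
        ext x
        have := LinearEquiv.congr_fun (P.reflection_reflectionPerm (i := j) (j := i))
          (P.reflection i x)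
        simp only [LinearEquiv.mul_apply, reflection_same] at this
        exact this
      | one =>
        intro j k hk
        rw [one_smul] at hk
        rw [P.root.injective hk, mul_one, one_mul]
      | mul x y hx hy ihx ihy =>
        intro j k hk
        rw [mul_smul] at hk
        have hy' : y • P.root j = P.root (P.weylGroupToPerm ⟨y, hy⟩ j) :=
          weylGroup_apply_root P ⟨y, hy⟩ j
        rw [hy'] at hk
        rw [← mul_assoc, ihx _ _ hk, mul_assoc, ihy _ _ hy', mul_assoc]
    exact Subtype.ext (key g hg j k hk)
  rcases h with h | h
  · exact hperm i h
  -- The index of `-α_i` is `reflectionPerm i i`, and its reflection is again `s_i`.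
  · have := hperm (P.reflectionPerm i i) (by rw [h, root_reflectionPerm, reflection_apply_self])
    rw [← this]
    congr 1
    apply weyl_ext
    intro x
    simp only [simpleRefl, weylGroup.ofIdx_smul, Equiv.reflection_smul, reflection_reflectionPerm]
    simp

@[simp] lemma wordProd_nil : wordProd b [] = 1 := rfl

@[simp] lemma wordProd_cons (i : b.support) (ω : List b.support) :
    wordProd b (i :: ω) = simpleRefl b i * wordProd b ω := by simp [wordProd]

@[simp] lemma wordProd_append (ω ω' : List b.support) :
    wordProd b (ω ++ ω') = wordProd b ω * wordProd b ω' := by simp [wordProd]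

lemma wordProd_reverse (ω : List b.support) : wordProd b ω.reverse = (wordProd b ω)⁻¹ := by
  induction ω with
  | nil => simp
  | cons i ω ih => simp [ih, simpleRefl_inv]

/-! ### Positivity -/

lemma root_mem_posCone (i : b.support) : P.root i ∈ posCone b :=
  AddSubmonoid.subset_closure ⟨i, i.2, rfl⟩

lemma height_nonneg_of_mem_posCone {k : ι} (h : P.root k ∈ posCone b) : 0 ≤ b.height k := by
  rw [posCone, ← Submodule.span_nat_eq_addSubmonoidClosure, Submodule.mem_toAddSubmonoid,
    Submodule.mem_span_image_finset_iff_exists_fun] at h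
  obtain ⟨c, hc⟩ := h
  classical
  let f : ι → ℤ := fun j ↦ if h : j ∈ b.support then (c ⟨j, h⟩ : ℤ) else 0
  have hc' : P.root k = ∑ j ∈ b.support, f j • P.root j := by
    rw [← hc, ← Finset.sum_coe_sort b.support]
    simp [f]
  rw [Base.height_eq_sum hc']
  refine Finset.sum_nonneg fun j hj ↦ ?_
  simp [f, hj]

/-- If a positive root were outside the cone, its negative would lie in it and have nonnegative
height. The cone form of positivity is convenient because it is closed under addition. -/
lemma root_mem_posCone_iff (k : ι) : P.root k ∈ posCone b ↔ b.IsPos k := by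
  refine ⟨fun h ↦ b.isPos_iff'.2 (height_nonneg_of_mem_posCone b h), fun h ↦ ?_⟩
  refine (b.root_mem_or_neg_mem k).resolve_right fun hn ↦ ?_
  let := P.indexNeg
  have := height_nonneg_of_mem_posCone b (k := -k) (by simpa [posCone] using hn)
  rw [b.height_reflectionPerm_self] at this
  rw [Base.isPos_iff] at h
  omega

lemma neg_root_mem_posCone_iff (k : ι) : -P.root k ∈ posCone b ↔ P.root k ∉ posCone b := by
  let := P.indexNeg
  have := root_mem_posCone_iff b (-k)
  rw [Base.IsPos.neg_iff_not, ← root_mem_posCone_iff] at this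
  simpa using this

lemma neg_smul_root_mem_posCone_iff (w : P.weylGroup) (k : ι) :
    -(w • P.root k) ∈ posCone b ↔ w • P.root k ∉ posCone b := by
  rw [weylGroup_apply_root, neg_root_mem_posCone_iff]

variable [Finite ι] [P.IsReduced]

/-- In a reduced system a simple reflection permutes the positive roots other than its own simple
root. -/
lemma simpleRefl_smul_mem_posCone {w : P.weylGroup} {k : ι} {j : b.support}
    (h : w • P.root k ∈ posCone b) (hne : w • P.root k ≠ P.root j) :
    simpleRefl b j • w • P.root k ∈ posCone b := by
  rw [weylGroup_apply_root] at h hne ⊢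
  rw [simpleRefl, weylGroup.ofIdx_smul, Equiv.reflection_smul, ← root_reflectionPerm,
    root_mem_posCone_iff]
  rw [root_mem_posCone_iff] at h
  exact h.reflectionPerm j.2 fun e ↦ hne (by rw [e])

/-! ### Length -/

@[simp] lemma len_one : len b (1 : P.weylGroup) = 0 :=
  Nat.le_zero.1 (len_wordProd_le b [])

lemma len_mul_le (v w : P.weylGroup) : len b (v * w) ≤ len b v + len b w := by
  obtain ⟨ω, hl, rfl⟩ := exists_reduced b v
  obtain ⟨ω', hl', rfl⟩ := exists_reduced b w
  rw [← hl, ← hl', ← wordProd_append, ← List.length_append]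
  exact len_wordProd_le b _

lemma len_simpleRefl_le (i : b.support) : len b (simpleRefl b i) ≤ 1 := by
  simpa using len_wordProd_le b [i]

lemma len_inv (w : P.weylGroup) : len b w⁻¹ = len b w := by
  have key : ∀ w : P.weylGroup, len b w⁻¹ ≤ len b w := by
    intro w
    obtain ⟨ω, hl, rfl⟩ := exists_reduced b w
    rw [← hl, ← wordProd_reverse, ← List.length_reverse]
    exact len_wordProd_le b _
  exact le_antisymm (key w) (by simpa using key w⁻¹)

/-- The exchange condition. Follow `α_i` under the inverses of the prefixes of the word: at a letter
`j` where it leaves the positive cone it must equal `α_j`, and conjugation then deletes that letter.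
-/
lemma exists_wordProd_eq_simpleRefl_mul (i : b.support) (ω : List b.support)
    (h : (wordProd b ω)⁻¹ • P.root i ∉ posCone b) :
    ∃ ω' : List b.support, ω'.length + 1 = ω.length ∧
      wordProd b ω' = simpleRefl b i * wordProd b ω := by
  induction ω using List.reverseRecOn with
  | nil => exact absurd (root_mem_posCone b i) (by simpa using h)
  | append_singleton ω j ih =>
    by_cases h0 : (wordProd b ω)⁻¹ • P.root i ∈ posCone b
    · by_cases h1 : (wordProd b ω)⁻¹ • P.root i = P.root j
      · refine ⟨ω, by simp, ?_⟩
        have := simpleRefl_mul_eq_of_smul_root b (w := wordProd b ω) (i := i) (j := j)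
          (Or.inl (by rw [← h1, smul_inv_smul]))
        rw [wordProd_append, ← mul_assoc, this]
        simp
      -- A positive root other than `α_j` would remain positive, against `h`.
      · refine absurd (simpleRefl_smul_mem_posCone b h0 h1) ?_
        rw [← mul_smul]
        simpa [simpleRefl_inv] using h
    · obtain ⟨ω', hl, hp⟩ := ih h0
      exact ⟨ω' ++ [j], by simp [hl], by simp [hp, mul_assoc]⟩

lemma len_simpleRefl_mul_of_notMem {i : b.support} {w : P.weylGroup}
    (h : w⁻¹ • P.root i ∉ posCone b) : len b (simpleRefl b i * w) + 1 = len b w := by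
  obtain ⟨ω, hl, rfl⟩ := exists_reduced b w
  obtain ⟨ω', hl', hp⟩ := exists_wordProd_eq_simpleRefl_mul b i ω h
  have h1 := len_wordProd_le b ω'
  rw [hp] at h1
  have h2 := len_mul_le b (simpleRefl b i) (simpleRefl b i * wordProd b ω)
  rw [simpleRefl_mul_cancel_left] at h2
  have := len_simpleRefl_le b i
  omega

lemma len_simpleRefl_mul_of_mem {i : b.support} {w : P.weylGroup}
    (h : w⁻¹ • P.root i ∈ posCone b) : len b (simpleRefl b i * w) = len b w + 1 := by
  have := len_simpleRefl_mul_of_notMem b (i := i) (w := simpleRefl b i * w) (by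
    rw [mul_inv_rev, simpleRefl_inv, mul_smul, simpleRefl_smul_self, smul_neg,
      neg_smul_root_mem_posCone_iff]
    exact not_not.2 h)
  rw [simpleRefl_mul_cancel_left] at this
  omega

lemma len_lt_simpleRefl_mul_iff {i : b.support} {w : P.weylGroup} :
    len b w < len b (simpleRefl b i * w) ↔ w⁻¹ • P.root i ∈ posCone b := by
  refine ⟨fun h ↦ ?_, fun h ↦ by rw [len_simpleRefl_mul_of_mem b h]; omega⟩
  by_contra hn
  have := len_simpleRefl_mul_of_notMem b hn
  omega

lemma len_mul_simpleRefl (w : P.weylGroup) (i : b.support) :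
    len b (w * simpleRefl b i) = len b (simpleRefl b i * w⁻¹) := by
  rw [← len_inv, mul_inv_rev, simpleRefl_inv]

lemma len_simpleRefl_mul_or (i : b.support) (w : P.weylGroup) :
    len b (simpleRefl b i * w) = len b w + 1 ∨ len b (simpleRefl b i * w) + 1 = len b w := by
  by_cases h : w⁻¹ • P.root i ∈ posCone b
  · exact Or.inl (len_simpleRefl_mul_of_mem b h)
  · exact Or.inr (len_simpleRefl_mul_of_notMem b h)

/-- Unless `s_i w = w s_j`, right multiplication by `s_j` does not affect whether `s_i` is a left
descent. -/
lemma len_lt_simpleRefl_mul_mul_iff {i j : b.support} {w : P.weylGroup}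
    (hne : simpleRefl b i * w ≠ w * simpleRefl b j) :
    len b (w * simpleRefl b j) < len b (simpleRefl b i * (w * simpleRefl b j)) ↔
      len b w < len b (simpleRefl b i * w) := by
  rw [len_lt_simpleRefl_mul_iff, len_lt_simpleRefl_mul_iff, mul_inv_rev, simpleRefl_inv, mul_smul]
  have h1 : w⁻¹ • P.root i ≠ P.root j := fun h ↦
    hne (simpleRefl_mul_eq_of_smul_root b (Or.inl (by rw [← h, smul_inv_smul])))
  have h2 : w⁻¹ • P.root i ≠ -P.root j := fun h ↦
    hne (simpleRefl_mul_eq_of_smul_root b (Or.inr (by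
      rw [eq_comm, neg_eq_iff_eq_neg, ← smul_neg, ← h, smul_inv_smul])))
  refine ⟨fun h ↦ ?_, fun h ↦ simpleRefl_smul_mem_posCone b h h1⟩
  rw [← mul_smul] at h
  have := simpleRefl_smul_mem_posCone b (j := j) h (fun e ↦ h2 (by
    rw [mul_smul] at e
    rw [← simpleRefl_smul_self, ← e, ← mul_smul, simpleRefl_mul_self, one_smul]))
  rwa [← mul_smul, simpleRefl_mul_cancel_left] at this

end RootsAndLength

/-! ### The regular representation and the basis `T_w`. -/

section HeckeStructure

variable {ι X Y : Type*} [Finite ι] [AddCommGroup X] [AddCommGroup Y] {P : RootDatum ι X Y}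
  [P.IsReduced] (b : P.Base)

/-- Right multiplication by `T_s` on the free module with basis `(T_w)`. -/
noncomputable def heckeOpRight (j : b.support) :
    Module.End (FunField X) (P.weylGroup →₀ FunField X) :=
  Finsupp.linearCombination (FunField X) fun w ↦
    if len b w < len b (w * simpleRefl b j) then Finsupp.single (w * simpleRefl b j) 1
    else Finsupp.single w (qv - 1) + Finsupp.single (w * simpleRefl b j) qv

lemma heckeOp_single_of_lt {i : b.support} {w : P.weylGroup} (a : FunField X)
    (h : len b w < len b (simpleRefl b i * w)) :
    heckeOp b i (Finsupp.single w a) = Finsupp.single (simpleRefl b i * w) a := by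
  simp [heckeOp, h]

lemma heckeOp_single_of_not_lt {i : b.support} {w : P.weylGroup} (a : FunField X)
    (h : ¬ len b w < len b (simpleRefl b i * w)) :
    heckeOp b i (Finsupp.single w a) =
      Finsupp.single w (a * (qv - 1)) + Finsupp.single (simpleRefl b i * w) (a * qv) := by
  rw [heckeOp, Finsupp.linearCombination_single, if_neg h, smul_add, Finsupp.smul_single,
    Finsupp.smul_single, smul_eq_mul, smul_eq_mul]

lemma heckeOpRight_single_of_lt {j : b.support} {w : P.weylGroup} (a : FunField X)
    (h : len b w < len b (w * simpleRefl b j)) :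
    heckeOpRight b j (Finsupp.single w a) = Finsupp.single (w * simpleRefl b j) a := by
  simp [heckeOpRight, h]

lemma heckeOpRight_single_of_not_lt {j : b.support} {w : P.weylGroup} (a : FunField X)
    (h : ¬ len b w < len b (w * simpleRefl b j)) :
    heckeOpRight b j (Finsupp.single w a) =
      Finsupp.single w (a * (qv - 1)) + Finsupp.single (w * simpleRefl b j) (a * qv) := by
  rw [heckeOpRight, Finsupp.linearCombination_single, if_neg h, smul_add, Finsupp.smul_single,
    Finsupp.smul_single, smul_eq_mul, smul_eq_mul]

/-- This degenerate case is the one in which a right multiplication can change the left descent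
status. -/
lemma heckeOp_eq_heckeOpRight {i j : b.support} {w : P.weylGroup} (a : FunField X)
    (h : simpleRefl b i * w = w * simpleRefl b j) :
    heckeOp b i (Finsupp.single w a) = heckeOpRight b j (Finsupp.single w a) := by
  simp [heckeOp, heckeOpRight, h]

lemma len_lt_mul_simpleRefl_mul_iff {i j : b.support} {w : P.weylGroup}
    (hne : simpleRefl b i * w ≠ w * simpleRefl b j) :
    len b (simpleRefl b i * w) < len b (simpleRefl b i * w * simpleRefl b j) ↔
      len b w < len b (w * simpleRefl b j) := by
  have := len_lt_simpleRefl_mul_mul_iff b (i := j) (j := i) (w := w⁻¹) (fun h ↦ hne (by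
    have := congrArg (·⁻¹) h
    simp only [mul_inv_rev, inv_inv, simpleRefl_inv] at this
    exact this.symm))
  rw [← len_inv b (simpleRefl b i * w), ← len_inv b (simpleRefl b i * w * simpleRefl b j),
    ← len_inv b w, ← len_inv b (w * simpleRefl b j)]
  simpa only [mul_inv_rev, simpleRefl_inv] using this

/-- If `s_i w = w s_j`, the two operators agree on `T_w` and on `T_{w s_j}`. Otherwise each
multiplication preserves the ascent status for the other, and the four cases are formal. -/
lemma heckeOp_heckeOpRight_comm (i j : b.support) :
    heckeOp b i * heckeOpRight b j = heckeOpRight b j * heckeOp b i := by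
  refine Finsupp.lhom_ext' fun w ↦ LinearMap.ext_ring ?_
  simp only [LinearMap.comp_apply, Module.End.mul_apply, Finsupp.lsingle_apply]
  by_cases hc : simpleRefl b i * w = w * simpleRefl b j
  · have hc' : simpleRefl b i * (w * simpleRefl b j) = w * simpleRefl b j * simpleRefl b j := by
      rw [← mul_assoc, hc]
    rw [heckeOp_eq_heckeOpRight b 1 hc]
    by_cases h : len b w < len b (w * simpleRefl b j)
    · rw [heckeOpRight_single_of_lt b _ h, heckeOp_eq_heckeOpRight b 1 hc']
    · rw [heckeOpRight_single_of_not_lt b _ h, map_add, map_add, heckeOp_eq_heckeOpRight b _ hc,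
        heckeOp_eq_heckeOpRight b _ hc']
  · have h1 := len_lt_simpleRefl_mul_mul_iff b hc
    have h2 := len_lt_mul_simpleRefl_mul_iff b hc
    by_cases hl : len b w < len b (simpleRefl b i * w) <;>
    by_cases hr : len b w < len b (w * simpleRefl b j)
    · rw [heckeOpRight_single_of_lt b _ hr, heckeOp_single_of_lt b _ hl,
        heckeOp_single_of_lt b _ (h1.2 hl), heckeOpRight_single_of_lt b _ (h2.2 hr), mul_assoc]
    · rw [heckeOpRight_single_of_not_lt b _ hr, heckeOp_single_of_lt b _ hl, map_add,
        heckeOp_single_of_lt b _ (h1.2 hl), heckeOp_single_of_lt b _ hl,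
        heckeOpRight_single_of_not_lt b _ (mt h2.1 hr), mul_assoc]
    · rw [heckeOpRight_single_of_lt b _ hr, heckeOp_single_of_not_lt b _ hl, map_add,
        heckeOp_single_of_not_lt b _ (mt h1.1 hl), heckeOpRight_single_of_lt b _ hr,
        heckeOpRight_single_of_lt b _ (h2.2 hr), mul_assoc]
    · rw [heckeOpRight_single_of_not_lt b _ hr, heckeOp_single_of_not_lt b _ hl, map_add, map_add,
        heckeOp_single_of_not_lt b _ (mt h1.1 hl), heckeOp_single_of_not_lt b _ hl,
        heckeOpRight_single_of_not_lt b _ (mt h2.1 hr), heckeOpRight_single_of_not_lt b _ hr,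
        mul_assoc, add_add_add_comm]
      simp only [one_mul, mul_comm (qv : FunField X)]
      abel

/-- The generators centralise right multiplication, hence so does the algebra they generate. -/
lemma apply_heckeOpRight (h : HeckeAlg b) (j : b.support) (x : P.weylGroup →₀ FunField X) :
    (h : Module.End (FunField X) (P.weylGroup →₀ FunField X)) (heckeOpRight b j x) =
      heckeOpRight b j (h.1 x) := by
  have hle : HeckeAlg b ≤ Subalgebra.centralizer (FunField X) {heckeOpRight b j} := by
    refine Algebra.adjoin_le ?_
    rintro - ⟨i, rfl⟩
    rw [SetLike.mem_coe, Subalgebra.mem_centralizer_iff]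
    rintro - rfl
    exact (heckeOp_heckeOpRight_comm b i j).symm
  have := (Subalgebra.mem_centralizer_iff _).1 (hle h.2) _ rfl
  exact (LinearMap.congr_fun this x).symm

lemma exists_mul_simpleRefl_lt {w : P.weylGroup} (h : w ≠ 1) :
    ∃ j : b.support, len b (w * simpleRefl b j) < len b w := by
  obtain ⟨ω, hl, rfl⟩ := exists_reduced b w
  rcases List.eq_nil_or_concat ω with rfl | ⟨ω', j, rfl⟩
  · simp at h
  · refine ⟨j, ?_⟩
    rw [← hl]
    have := len_wordProd_le b ω'
    simp only [List.concat_eq_append, wordProd_append, wordProd_cons, wordProd_nil, mul_one,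
      simpleRefl_mul_cancel_right, List.length_append, List.length_singleton] at this ⊢
    omega

/-- An element of the Hecke algebra is determined by its value on `T_1`. -/
lemma heckeAlg_ext {h h' : HeckeAlg b}
    (e : h.1 (Finsupp.single 1 1) = h'.1 (Finsupp.single 1 1)) : h = h' := by
  refine Subtype.ext (Finsupp.lhom_ext' fun w ↦ LinearMap.ext_ring ?_)
  simp only [LinearMap.comp_apply, Finsupp.lsingle_apply]
  -- For `w ≠ 1`, `T_w` is a right multiple by some `T_s` of a shorter basis vector, and right
  -- multiplication commutes with both elements.
  induction hn : len b w using Nat.strong_induction_on generalizing w with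
  | _ n ih =>
    by_cases hw : w = 1
    · rw [hw, e]
    · obtain ⟨j, hj⟩ := exists_mul_simpleRefl_lt b hw
      have : (Finsupp.single w 1 : P.weylGroup →₀ FunField X) =
          heckeOpRight b j (Finsupp.single (w * simpleRefl b j) 1) := by
        rw [heckeOpRight_single_of_lt] <;> simp [hj]
      rw [this, apply_heckeOpRight, apply_heckeOpRight, ih _ (hn ▸ hj) _ rfl]

/-- Left and right multiplication by `T_s` agree on `T_1`, so right multiplication in the algebra
can be computed on vectors. -/
lemma mul_Tsimple_apply_one (h : HeckeAlg b) (j : b.support) :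
    (h * Tsimple b j).1 (Finsupp.single 1 1) = heckeOpRight b j (h.1 (Finsupp.single 1 1)) := by
  have h1 : heckeOp b j (Finsupp.single 1 1) = heckeOpRight b j (Finsupp.single 1 1) :=
    heckeOp_eq_heckeOpRight b _ (by simp)
  change h.1 (heckeOp b j _) = _
  rw [h1, apply_heckeOpRight]

lemma Tsimple_mul_self (i : b.support) :
    Tsimple b i * Tsimple b i = (qv - 1 : FunField X) • Tsimple b i +
      algebraMap (FunField X) (HeckeAlg b) qv := by
  apply Subtype.ext
  change heckeOp b i * heckeOp b i = (qv - 1 : FunField X) • heckeOp b i +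
    algebraMap (FunField X) (Module.End (FunField X) (P.weylGroup →₀ FunField X)) qv
  refine Finsupp.lhom_ext' fun w ↦ LinearMap.ext_ring ?_
  simp only [LinearMap.comp_apply, Finsupp.lsingle_apply, Module.End.mul_apply, LinearMap.add_apply,
    LinearMap.smul_apply, Module.algebraMap_end_apply]
  have := len_simpleRefl_mul_or b i w
  by_cases h : len b w < len b (simpleRefl b i * w)
  · rw [heckeOp_single_of_lt b _ h, heckeOp_single_of_not_lt b _ (by simp; omega)]
    simp [add_comm]
  · rw [heckeOp_single_of_not_lt b _ h, map_add, heckeOp_single_of_not_lt b _ h,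
      heckeOp_single_of_lt b _ (by simp; omega)]
    simp only [one_mul, simpleRefl_mul_cancel_left, smul_add, Finsupp.smul_single, smul_eq_mul,
      mul_one]

lemma prod_Tsimple_apply_one {ω : List b.support} (h : len b (wordProd b ω) = ω.length) :
    (ω.map (Tsimple b)).prod.1 (Finsupp.single 1 1) =
      (Finsupp.single (wordProd b ω) 1 : P.weylGroup →₀ FunField X) := by
  have : (ω.map (Tsimple b)).prod.1 = ((ω.map (heckeOp b)).prod :
      Module.End (FunField X) (P.weylGroup →₀ FunField X)) := by
    rw [← Subalgebra.coe_val, map_list_prod, List.map_map]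
    rfl
  rw [this, heckeOp_word b ω h]

lemma redWord_length (w : P.weylGroup) : (redWord b w).length = len b w :=
  (exists_reduced b w).choose_spec.1

lemma wordProd_redWord (w : P.weylGroup) : wordProd b (redWord b w) = w :=
  (exists_reduced b w).choose_spec.2

lemma T_apply_one (w : P.weylGroup) :
    (T b w).1 (Finsupp.single 1 1) = (Finsupp.single w 1 : P.weylGroup →₀ FunField X) := by
  rw [T, prod_Tsimple_apply_one b (by rw [wordProd_redWord, redWord_length]), wordProd_redWord]

/-- The product of the `T_s` along a reduced word depends only on the product of the word. -/
lemma prod_Tsimple_eq {ω ω' : List b.support} (h : wordProd b ω = wordProd b ω')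
    (hω : len b (wordProd b ω) = ω.length) (hω' : len b (wordProd b ω') = ω'.length) :
    (ω.map (Tsimple b)).prod = (ω'.map (Tsimple b)).prod :=
  heckeAlg_ext b (by rw [prod_Tsimple_apply_one b hω, prod_Tsimple_apply_one b hω', h])

lemma eq_sum_heckeCoeff (h : HeckeAlg b) :
    h = ∑ w : P.weylGroup, heckeCoeff b h w • T b w := by
  refine heckeAlg_ext b ?_
  rw [AddSubmonoidClass.coe_finsetSum, LinearMap.sum_apply]
  simp only [Subalgebra.coe_smul, LinearMap.smul_apply, T_apply_one]
  simp only [heckeCoeff, Finsupp.smul_single, smul_eq_mul, mul_one]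
  exact (Finsupp.univ_sum_single _).symm

end HeckeStructure

/-! ### The Yang–Baxter equations of rank two -/

section YangBaxter

variable {K A : Type*} [CommRing K] [Semiring A] [Algebra K A]

lemma yangBaxter_two (c d : K) {S T : A} (h : S * T = T * S) :
    (S + algebraMap K A c) * (T + algebraMap K A d) =
      (T + algebraMap K A d) * (S + algebraMap K A c) := by
  simp only [Algebra.algebraMap_eq_smul_one, mul_add, add_mul, smul_mul_assoc, mul_smul_comm,
    smul_add, smul_smul, one_mul, mul_one, h]
  module

/-- The nesting of scalars and products is the one produced by iterating `muWord_cons_eq`, with `p =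
q⁻¹`. The other `_smul` versions have the same purpose. -/
lemma yangBaxter_two_smul (p c d : K) {S T : A} (h : S * T = T * S) :
    p • (p • (1 * (S + algebraMap K A c)) * (T + algebraMap K A d)) =
      p • (p • (1 * (T + algebraMap K A d)) * (S + algebraMap K A c)) := by
  simp only [smul_mul_assoc, one_mul]
  rw [yangBaxter_two _ _ h]

/-- Once both sides are reduced by the braid and quadratic relations, `h1` is the only condition
left on the scalars. -/
lemma yangBaxter_three {q a b c : K} {S T : A} (hS : S * S = (q - 1) • S + algebraMap K A q)
    (hT : T * T = (q - 1) • T + algebraMap K A q) (h : S * (T * S) = T * (S * T))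
    (h1 : a * b + b * c + b = a * c) :
    (S + algebraMap K A ((q - 1) * a)) * ((T + algebraMap K A ((q - 1) * b)) *
      (S + algebraMap K A ((q - 1) * c))) =
    (T + algebraMap K A ((q - 1) * c)) * ((S + algebraMap K A ((q - 1) * b)) *
      (T + algebraMap K A ((q - 1) * a))) := by
  simp only [Algebra.algebraMap_eq_smul_one] at hS hT ⊢
  simp only [mul_add, add_mul, smul_mul_assoc, mul_smul_comm, mul_assoc, smul_add, smul_smul,
    one_mul, mul_one, h, hS, hT]
  -- Coefficients are compared monomial by monomial; those that do not agree identically differ by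
  -- `±(q-1)²` times `h1`.
  match_scalars <;> first
    | ring1
    | linear_combination (q - 1) ^ 2 * h1
    | linear_combination -(q - 1) ^ 2 * h1

lemma yangBaxter_three_smul (p : K) {q a b c : K} {S T : A}
    (hS : S * S = (q - 1) • S + algebraMap K A q)
    (hT : T * T = (q - 1) • T + algebraMap K A q) (h : S * (T * S) = T * (S * T))
    (h1 : a * b + b * c + b = a * c) :
    p • (p • (p • (1 * (S + algebraMap K A ((q - 1) * a))) * (T + algebraMap K A ((q - 1) * b))) *
        (S + algebraMap K A ((q - 1) * c))) =
    p • (p • (p • (1 * (T + algebraMap K A ((q - 1) * c))) * (S + algebraMap K A ((q - 1) * b))) *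
        (T + algebraMap K A ((q - 1) * a))) := by
  simp only [smul_mul_assoc, mul_assoc, one_mul]
  rw [yangBaxter_three hS hT h h1]

lemma yangBaxter_four {q a b c d : K} {S T : A} (hS : S * S = (q - 1) • S + algebraMap K A q)
    (hT : T * T = (q - 1) • T + algebraMap K A q) (h : S * (T * (S * T)) = T * (S * (T * S)))
    (h1 : a * b + b * c + c * d + b + c = a * d) :
    (S + algebraMap K A ((q - 1) * a)) * ((T + algebraMap K A ((q - 1) * b)) *
      ((S + algebraMap K A ((q - 1) * c)) * (T + algebraMap K A ((q - 1) * d)))) =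
    (T + algebraMap K A ((q - 1) * d)) * ((S + algebraMap K A ((q - 1) * c)) *
      ((T + algebraMap K A ((q - 1) * b)) * (S + algebraMap K A ((q - 1) * a)))) := by
  have hS' (Z : A) : S * (S * Z) = (q - 1) • (S * Z) + q • Z := by
    rw [← mul_assoc, hS, add_mul, smul_mul_assoc, Algebra.smul_def q]
  have hT' (Z : A) : T * (T * Z) = (q - 1) • (T * Z) + q • Z := by
    rw [← mul_assoc, hT, add_mul, smul_mul_assoc, Algebra.smul_def q]
  simp only [Algebra.algebraMap_eq_smul_one] at hS hT ⊢
  simp only [mul_add, add_mul, smul_mul_assoc, mul_smul_comm, mul_assoc, smul_add, smul_smul,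
    one_mul, mul_one, h, hS, hT, hS', hT']
  match_scalars <;> first
    | ring1
    | linear_combination (q - 1) ^ 2 * h1
    | linear_combination -(q - 1) ^ 2 * h1

lemma yangBaxter_four_smul (p : K) {q a b c d : K} {S T : A}
    (hS : S * S = (q - 1) • S + algebraMap K A q)
    (hT : T * T = (q - 1) • T + algebraMap K A q) (h : S * (T * (S * T)) = T * (S * (T * S)))
    (h1 : a * b + b * c + c * d + b + c = a * d) :
    p • (p • (p • (p • (1 * (S + algebraMap K A ((q - 1) * a))) * (T + algebraMap K A ((q - 1) *
        b))) * (S + algebraMap K A ((q - 1) * c))) * (T + algebraMap K A ((q - 1) * d))) =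
    p • (p • (p • (p • (1 * (T + algebraMap K A ((q - 1) * d))) * (S + algebraMap K A ((q - 1) *
        c))) * (T + algebraMap K A ((q - 1) * b))) * (S + algebraMap K A ((q - 1) * a))) := by
  simp only [smul_mul_assoc, mul_assoc, one_mul]
  rw [yangBaxter_four hS hT h h1]

lemma yangBaxter_six {q a b c d e f : K} {S T : A} (hS : S * S = (q - 1) • S + algebraMap K A q)
    (hT : T * T = (q - 1) • T + algebraMap K A q)
    (h : S * (T * (S * (T * (S * T)))) = T * (S * (T * (S * (T * S)))))
    (h1 : a * b + b * c + c * d + d * e + e * f + b + c + d + e = a * f)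
    (h2 : c + a * c + d + b * d + c * e + d * f = b * f + a * e)
    (h3 : b * d + a * b * d + b * c * d + a * b * c * d + b * e + a * b * e + c * e + b * c * e +
      b * d * e + a * b * d * e + c * d * e + b * c * d * e + b * e * f + a * b * e * f +
      c * e * f + b * c * e * f + c * d * e * f =
      a * d * f + a * d * e * f + a * c * f + a * c * d * f + a * b * c * f) :
    (S + algebraMap K A ((q - 1) * a)) * ((T + algebraMap K A ((q - 1) * b)) *
      ((S + algebraMap K A ((q - 1) * c)) * ((T + algebraMap K A ((q - 1) * d)) *
      ((S + algebraMap K A ((q - 1) * e)) * (T + algebraMap K A ((q - 1) * f)))))) =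
    (T + algebraMap K A ((q - 1) * f)) * ((S + algebraMap K A ((q - 1) * e)) *
      ((T + algebraMap K A ((q - 1) * d)) * ((S + algebraMap K A ((q - 1) * c)) *
      ((T + algebraMap K A ((q - 1) * b)) * (S + algebraMap K A ((q - 1) * a)))))) := by
  have hS' (Z : A) : S * (S * Z) = (q - 1) • (S * Z) + q • Z := by
    rw [← mul_assoc, hS, add_mul, smul_mul_assoc, Algebra.smul_def q]
  have hT' (Z : A) : T * (T * Z) = (q - 1) • (T * Z) + q • Z := by
    rw [← mul_assoc, hT, add_mul, smul_mul_assoc, Algebra.smul_def q]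
  simp only [Algebra.algebraMap_eq_smul_one] at hS hT ⊢
  simp only [mul_add, add_mul, smul_mul_assoc, mul_smul_comm, mul_assoc, smul_add, smul_smul,
    one_mul, mul_one, h, hS, hT, hS', hT']
  -- Here powers of `q - 1` and `q` separate three conditions: `h1` enters with weight `(q-1)²`,
  -- `h2` with `q(q-1)²` and `h3` with `(q-1)⁴`.
  match_scalars <;> first
    | ring1
    | linear_combination (q - 1) ^ 2 * h1
    | linear_combination -(q - 1) ^ 2 * h1
    | linear_combination q * (q - 1) ^ 2 * h2 + (q - 1) ^ 4 * h3
    | linear_combination -q * (q - 1) ^ 2 * h2 - (q - 1) ^ 4 * h3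

lemma yangBaxter_six_smul (p : K) {q a b c d e f : K} {S T : A}
    (hS : S * S = (q - 1) • S + algebraMap K A q)
    (hT : T * T = (q - 1) • T + algebraMap K A q)
    (h : S * (T * (S * (T * (S * T)))) = T * (S * (T * (S * (T * S)))))
    (h1 : a * b + b * c + c * d + d * e + e * f + b + c + d + e = a * f)
    (h2 : c + a * c + d + b * d + c * e + d * f = b * f + a * e)
    (h3 : b * d + a * b * d + b * c * d + a * b * c * d + b * e + a * b * e + c * e + b * c * e +
      b * d * e + a * b * d * e + c * d * e + b * c * d * e + b * e * f + a * b * e * f +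
      c * e * f + b * c * e * f + c * d * e * f =
      a * d * f + a * d * e * f + a * c * f + a * c * d * f + a * b * c * f) :
    p • (p • (p • (p • (p • (p • (1 * (S + algebraMap K A ((q - 1) * a))) *
        (T + algebraMap K A ((q - 1) * b))) * (S + algebraMap K A ((q - 1) * c))) *
            (T + algebraMap K A ((q - 1) * d))) * (S + algebraMap K A ((q - 1) * e))) *
                (T + algebraMap K A ((q - 1) * f))) =
    p • (p • (p • (p • (p • (p • (1 * (T + algebraMap K A ((q - 1) * f))) *
        (S + algebraMap K A ((q - 1) * e))) * (T + algebraMap K A ((q - 1) * d))) *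
            (S + algebraMap K A ((q - 1) * c))) * (T + algebraMap K A ((q - 1) * b))) *
                (S + algebraMap K A ((q - 1) * a))) := by
  simp only [smul_mul_assoc, mul_assoc, one_mul]
  rw [yangBaxter_six hS hT h h1 h2 h3]

end YangBaxter

/-! ### Rational identities in two variables behind the Yang–Baxter equations. -/

section CayleyRelations

variable {K : Type*} [Field K]

/-- The relations between the `z ^ β / (1 - z ^ β)` for the positive roots `β` of `A₂`. -/
lemma cayley_relation_three {x y a b c : K}
    (ha : 1 - x ^ 1 * y ^ 0 ≠ 0)
    (hb : 1 - x ^ 1 * y ^ 1 ≠ 0)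
    (hc : 1 - x ^ 0 * y ^ 1 ≠ 0)
    (ea : a * (1 - x ^ 1 * y ^ 0) = x ^ 1 * y ^ 0)
    (eb : b * (1 - x ^ 1 * y ^ 1) = x ^ 1 * y ^ 1)
    (ec : c * (1 - x ^ 0 * y ^ 1) = x ^ 0 * y ^ 1) :
    a * b + b * c + b = a * c := by
  rw [← eq_div_iff (by assumption)] at ea eb ec
  subst ea eb ec
  simp only [pow_zero, pow_one, mul_one, one_mul] at ha hb hc ⊢
  field_simp
  ring

/-- The relations between the `z ^ β / (1 - z ^ β)` for the positive roots `β` of `B₂`. -/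
lemma cayley_relation_four {x y a b c d : K}
    (ha : 1 - x ^ 1 * y ^ 0 ≠ 0)
    (hb : 1 - x ^ 2 * y ^ 1 ≠ 0)
    (hc : 1 - x ^ 1 * y ^ 1 ≠ 0)
    (hd : 1 - x ^ 0 * y ^ 1 ≠ 0)
    (ea : a * (1 - x ^ 1 * y ^ 0) = x ^ 1 * y ^ 0)
    (eb : b * (1 - x ^ 2 * y ^ 1) = x ^ 2 * y ^ 1)
    (ec : c * (1 - x ^ 1 * y ^ 1) = x ^ 1 * y ^ 1)
    (ed : d * (1 - x ^ 0 * y ^ 1) = x ^ 0 * y ^ 1) :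
    a * b + b * c + c * d + b + c = a * d := by
  rw [← eq_div_iff (by assumption)] at ea eb ec ed
  subst ea eb ec ed
  simp only [pow_zero, pow_one, mul_one, one_mul] at ha hb hc hd ⊢
  field_simp
  ring

/-- The relations between the `z ^ β / (1 - z ^ β)` for the positive roots `β` of `G₂`. -/
lemma cayley_relation_six {x y a b c d e f : K}
    (ha : 1 - x ^ 1 * y ^ 0 ≠ 0)
    (hb : 1 - x ^ 3 * y ^ 1 ≠ 0)
    (hc : 1 - x ^ 2 * y ^ 1 ≠ 0)
    (hd : 1 - x ^ 3 * y ^ 2 ≠ 0)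
    (he : 1 - x ^ 1 * y ^ 1 ≠ 0)
    (hf : 1 - x ^ 0 * y ^ 1 ≠ 0)
    (ea : a * (1 - x ^ 1 * y ^ 0) = x ^ 1 * y ^ 0)
    (eb : b * (1 - x ^ 3 * y ^ 1) = x ^ 3 * y ^ 1)
    (ec : c * (1 - x ^ 2 * y ^ 1) = x ^ 2 * y ^ 1)
    (ed : d * (1 - x ^ 3 * y ^ 2) = x ^ 3 * y ^ 2)
    (ee : e * (1 - x ^ 1 * y ^ 1) = x ^ 1 * y ^ 1)
    (ef : f * (1 - x ^ 0 * y ^ 1) = x ^ 0 * y ^ 1) :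
    a * b + b * c + c * d + d * e + e * f + b + c + d + e = a * f ∧
    c + a * c + d + b * d + c * e + d * f = b * f + a * e ∧
    b * d + a * b * d + b * c * d + a * b * c * d + b * e + a * b * e + c * e + b * c * e +
      b * d * e + a * b * d * e + c * d * e + b * c * d * e + b * e * f + a * b * e * f +
      c * e * f + b * c * e * f + c * d * e * f =
      a * d * f + a * d * e * f + a * c * f + a * c * d * f + a * b * c * f := by
  rw [← eq_div_iff (by assumption)] at ea eb ec ed ee ef
  subst ea eb ec ed ee ef
  simp only [pow_zero, pow_one, mul_one, one_mul] at ha hb hc hd he hf ⊢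
  refine ⟨?_, ?_, ?_⟩ <;> field_simp <;> ring

end CayleyRelations

/-! ### Characters of the torus in the function field. -/

section Characters

variable {X : Type*} [AddCommGroup X]

lemma zpow_add (lam mu : X) : zpow (lam + mu) = zpow lam * zpow mu := by
  rw [zpow, zpow, zpow, ← map_mul, AddMonoidAlgebra.single_mul_single]
  simp

lemma zpow_nsmul (n : ℕ) (lam : X) : zpow (n • lam) = zpow lam ^ n := by
  rw [zpow, zpow, ← map_pow, AddMonoidAlgebra.single_pow]
  simp

lemma qv_ne_zero : (qv : FunField X) ≠ 0 := by
  rw [qv, map_ne_zero_iff _ (IsFractionRing.injective _ _)]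
  exact AddMonoidAlgebra.single_ne_zero.2 one_ne_zero

lemma one_sub_zpow_ne_zero {lam : X} (h : lam ≠ 0) : 1 - zpow lam ≠ 0 := by
  rw [sub_ne_zero, zpow, ← map_one (algebraMap (CoordRing X) (FunField X)), Ne,
    (IsFractionRing.injective (CoordRing X) (FunField X)).eq_iff]
  intro e
  have := congrArg Prod.snd (AddMonoidAlgebra.single_left_injective one_ne_zero e)
  exact h this.symm

end Characters

/-! ### Braid relations for `μ` in rank two. -/

section RankTwo

variable {ι X Y : Type*} [Finite ι] [AddCommGroup X] [AddCommGroup Y] {P : RootDatum ι X Y}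
  [P.IsReduced] (b : P.Base)

/-- The letters of a word are successive left descents of `w`. -/
def Descends : List b.support → P.weylGroup → Prop
  | [], _ => True
  | i :: ω, w => -(w⁻¹ • P.root i) ∈ posCone b ∧ Descends ω (simpleRefl b i * w)

lemma Descends.len_eq {b : P.Base} {ω : List b.support} {w : P.weylGroup} (h : Descends b ω w) :
    len b ((wordProd b ω)⁻¹ * w) + ω.length = len b w := by
  induction ω generalizing w with
  | nil => simp
  | cons i ω ih =>
    have h1 := ih h.2
    have h2 := len_simpleRefl_mul_of_notMem b ((neg_smul_root_mem_posCone_iff b _ _).1 h.1)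
    rw [← mul_assoc] at h1
    rw [wordProd_cons, mul_inv_rev, simpleRefl_inv, List.length_cons]
    omega

variable [Module.Free ℤ X]

omit [Finite ι] [P.IsReduced] [Module.Free ℤ X] in
lemma one_sub_zpow_smul_root_ne_zero (w : P.weylGroup) (k : ι) :
    1 - zpow (w • P.root k) ≠ 0 := by
  rw [weylGroup_apply_root]
  refine one_sub_zpow_ne_zero fun h ↦ ?_
  have := P.root_coroot'_eq_pairing (P.weylGroupToPerm w k) (P.weylGroupToPerm w k)
  rw [h] at this
  simp at this

/-- The value `z ^ lam / (1 - z ^ lam)`. -/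
noncomputable def cayley (lam : X) : FunField X := zpow lam / (1 - zpow lam)

-- Expresses the value at a root of rank two through the two variables `z^{xα_i}`, `z^{xα_j}`. The
-- element `v` only certifies that `lam` is a root, so that the denominator does not vanish.
omit [Finite ι] [P.IsReduced] in
lemma cayley_spec (x : P.weylGroup) {v : P.weylGroup} {k : ι} {lam : X} (i j : ι) (m n : ℕ)
    (h : v • P.root k = lam) (hl : lam = m • P.root i + n • P.root j) :
    1 - zpow (x • P.root i) ^ m * zpow (x • P.root j) ^ n ≠ 0 ∧
    cayley (x • lam) * (1 - zpow (x • P.root i) ^ m * zpow (x • P.root j) ^ n) =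
      zpow (x • P.root i) ^ m * zpow (x • P.root j) ^ n := by
  have e : zpow (x • P.root i) ^ m * zpow (x • P.root j) ^ n = zpow (x • lam) := by
    rw [hl, smul_add, ← zpow_nsmul, ← zpow_nsmul, ← zpow_add, smul_comm x m, smul_comm x n]
  have h0 : 1 - zpow (x • lam) ≠ 0 := by
    rw [← h, ← mul_smul]
    exact one_sub_zpow_smul_root_ne_zero _ k
  rw [e]
  exact ⟨h0, div_mul_cancel₀ _ h0⟩

lemma muSimple_eq (x : P.weylGroup) (i : b.support) :
    muSimple b x i = (qv : FunField X)⁻¹ • (Tsimple b i +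
      algebraMap (FunField X) (HeckeAlg b) ((qv - 1) * cayley (x⁻¹ • P.root i))) := by
  rw [muSimple, smul_add, Algebra.smul_def (qv⁻¹ : FunField X) (algebraMap _ _ _), ← map_mul,
    cayley]
  congr 2
  have := qv_ne_zero (X := X)
  field_simp

/-- `lam` is the inversion root contributed by the new letter. Taking the earlier product as `M`
lets the computations be chained letter by letter. -/
lemma muWord_cons_eq (x : P.weylGroup) {ω : List b.support} {i : b.support} {lam : X}
    {M : HeckeAlg b} (hM : muWord b x ω = M) (h : (wordProd b ω)⁻¹ • P.root i = lam) :
    muWord b x (i :: ω) = (qv : FunField X)⁻¹ • (M * (Tsimple b i +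
      algebraMap (FunField X) (HeckeAlg b) ((qv - 1) * cayley (x⁻¹ • lam)))) := by
  rw [muWord, muSimple_eq, mul_inv_rev, mul_smul, h, mul_smul_comm, hM]

/-- Two words for the same element along which the `μ` agree. -/
structure IsBraid (ω ω' : List b.support) : Prop where
  wordProd_eq : wordProd b ω = wordProd b ω'
  length_eq : ω.length = ω'.length
  muWord_eq : len b (wordProd b ω) = ω.length → ∀ x, muWord b x ω = muWord b x ω'
  -- This splits the rank-two longest element off `w` with lengths adding.
  descends : ∀ (w : P.weylGroup), (∀ i ∈ ω.head?, w⁻¹ • P.root i ∉ posCone b) →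
    (∀ i ∈ ω'.head?, w⁻¹ • P.root i ∉ posCone b) →
      len b ((wordProd b ω)⁻¹ * w) + ω.length = len b w

lemma IsBraid.symm {b : P.Base} {ω ω' : List b.support} (h : IsBraid b ω ω') :
    IsBraid b ω' ω where
  wordProd_eq := h.wordProd_eq.symm
  length_eq := h.length_eq.symm
  muWord_eq hl x := (h.muWord_eq (by rw [h.wordProd_eq, hl, h.length_eq]) x).symm
  descends w h1 h2 := by rw [← h.wordProd_eq, ← h.length_eq]; exact h.descends w h2 h1

variable {b} {i j : b.support}

lemma isBraid_two (hij : P.pairing i j = 0) (hji : P.pairing j i = 0) :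
    IsBraid b [i, j] [j, i] := by
  have a1 : simpleRefl b i • P.root j = P.root j := by simp [simpleRefl_smul_root, hji]
  have a2 : simpleRefl b j • P.root i = P.root i := by simp [simpleRefl_smul_root, hij]
  have hw : wordProd b [i, j] = wordProd b [j, i] := by
    simpa using simpleRefl_mul_eq_of_smul_root b (Or.inl a2)
  refine ⟨hw, rfl, fun hl x ↦ ?_, fun w h1 h2 ↦ ?_⟩
  · have hT := prod_Tsimple_eq b hw hl (by rw [← hw, hl]; rfl)
    simp only [List.map_cons, List.map_nil, List.prod_cons, List.prod_nil, mul_one] at hT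
    have l1 := muWord_cons_eq b x (muWord_cons_eq b x (i := j) (ω := []) rfl
      (by simp; rfl)) (i := i) (lam := P.root i) (by simpa [simpleRefl_inv] using a2)
    have l2 := muWord_cons_eq b x (muWord_cons_eq b x (i := i) (ω := []) rfl
      (by simp; rfl)) (i := j) (lam := P.root j) (by simpa [simpleRefl_inv] using a1)
    rw [l1, l2]
    exact yangBaxter_two_smul _ _ _ hT.symm
  · refine Descends.len_eq ?_
    simp only [List.head?_cons, Option.mem_some_iff, forall_eq'] at h1 h2
    rw [← neg_smul_root_mem_posCone_iff] at h1 h2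
    simp only [Descends, mul_inv_rev, simpleRefl_inv, mul_smul, a1, and_true]
    exact ⟨h1, h2⟩

/-- The two words run through the same positive roots in opposite orders (the `a`s and `b`s), which
is the shape of `yangBaxter_three`. The cases of B₂ and G₂ follow the same pattern. -/
lemma isBraid_three (hij : P.pairing i j = -1) (hji : P.pairing j i = -1) :
    IsBraid b [i, j, i] [j, i, j] := by
  have ni := simpleRefl_smul_self b i
  have nj := simpleRefl_smul_self b j
  have a1 : simpleRefl b i • P.root j = P.root i + P.root j := by
    rw [simpleRefl_smul_root, hji]; module
  have b1 : simpleRefl b j • P.root i = P.root i + P.root j := by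
    rw [simpleRefl_smul_root, hij]; module
  have a2 : simpleRefl b i • simpleRefl b j • P.root i = P.root j := by
    rw [b1]; simp only [smul_add, ni, a1]; abel
  have b2 : simpleRefl b j • simpleRefl b i • P.root j = P.root i := by
    rw [a1]; simp only [smul_add, nj, b1]; abel
  have hw : wordProd b [i, j, i] = wordProd b [j, i, j] := by
    simpa [mul_assoc] using simpleRefl_mul_eq_of_smul_root b
      (w := simpleRefl b j * simpleRefl b i) (Or.inl (by simp only [mul_smul]; exact b2))
  refine ⟨hw, rfl, fun hl x ↦ ?_, fun w h1 h2 ↦ ?_⟩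
  · have hT := prod_Tsimple_eq b hw hl (by rw [← hw, hl]; rfl)
    simp only [List.map_cons, List.map_nil, List.prod_cons, List.prod_nil, mul_one] at hT
    have hl0 := muWord_cons_eq b x (i := i) (lam := P.root i)
      (rfl : muWord b x [] = 1) (by simp)
    have hl1 := muWord_cons_eq b x (i := j) (lam := P.root i + P.root j)
      hl0 (by simpa [simpleRefl_inv, mul_smul] using a1)
    have hl2 := muWord_cons_eq b x (i := i) (lam := P.root j)
      hl1 (by simpa [simpleRefl_inv, mul_smul] using a2)
    have hr0 := muWord_cons_eq b x (i := j) (lam := P.root j)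
      (rfl : muWord b x [] = 1) (by simp)
    have hr1 := muWord_cons_eq b x (i := i) (lam := P.root i + P.root j)
      hr0 (by simpa [simpleRefl_inv, mul_smul] using b1)
    have hr2 := muWord_cons_eq b x (i := j) (lam := P.root i)
      hr1 (by simpa [simpleRefl_inv, mul_smul] using b2)
    rw [hl2, hr2]
    obtain ⟨n0, c0⟩ := cayley_spec x⁻¹ (v := 1) (k := i) i j 1 0
      (one_smul P.weylGroup (P.root i)) (by module)
    obtain ⟨n1, c1⟩ := cayley_spec x⁻¹ (v := simpleRefl b i) (k := j) i j 1 1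
      a1 (by module)
    obtain ⟨n2, c2⟩ := cayley_spec x⁻¹ (v := simpleRefl b i * simpleRefl b j) (k := i) i j 0 1
      (by simpa only [mul_smul] using a2) (by module)
    exact yangBaxter_three_smul _ (Tsimple_mul_self b i) (Tsimple_mul_self b j) hT
      (cayley_relation_three n0 n1 n2 c0 c1 c2)
  · refine Descends.len_eq ?_
    simp only [List.head?_cons, Option.mem_some_iff, forall_eq'] at h1 h2
    rw [← neg_smul_root_mem_posCone_iff] at h1 h2
    simp only [Descends, mul_inv_rev, simpleRefl_inv, mul_smul, and_true]
    -- Each inversion root is a sum of copies of `α_i` and `α_j`, both of which `w⁻¹` makes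
    -- negative.
    refine ⟨h1, ?_, ?_⟩
    · rw [a1]; simp only [smul_add, neg_add]
      repeat' first | assumption | apply add_mem
    · rw [a2]; exact h2

lemma isBraid_four (hij : P.pairing i j = -1) (hji : P.pairing j i = -2) :
    IsBraid b [i, j, i, j] [j, i, j, i] := by
  have ni := simpleRefl_smul_self b i
  have nj := simpleRefl_smul_self b j
  have a1 : simpleRefl b i • P.root j = P.root i + P.root i + P.root j := by
    rw [simpleRefl_smul_root, hji]; module
  have b1 : simpleRefl b j • P.root i = P.root i + P.root j := by
    rw [simpleRefl_smul_root, hij]; module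
  have a2 : simpleRefl b i • simpleRefl b j • P.root i = P.root i + P.root j := by
    rw [b1]; simp only [smul_add, ni, a1]; abel
  have b2 : simpleRefl b j • simpleRefl b i • P.root j = P.root i + P.root i + P.root j := by
    rw [a1]; simp only [smul_add, nj, b1]; abel
  have a3 : simpleRefl b i • simpleRefl b j • simpleRefl b i • P.root j = P.root j := by
    rw [b2]; simp only [smul_add, ni, a1]; abel
  have b3 : simpleRefl b j • simpleRefl b i • simpleRefl b j • P.root i = P.root i := by
    rw [a2]; simp only [smul_add, nj, b1]; abel
  have hw : wordProd b [i, j, i, j] = wordProd b [j, i, j, i] := by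
    simpa [mul_assoc] using simpleRefl_mul_eq_of_smul_root b
      (w := simpleRefl b j * simpleRefl b i * simpleRefl b j)
          (Or.inl (by simp only [mul_smul]; exact b3))
  refine ⟨hw, rfl, fun hl x ↦ ?_, fun w h1 h2 ↦ ?_⟩
  · have hT := prod_Tsimple_eq b hw hl (by rw [← hw, hl]; rfl)
    simp only [List.map_cons, List.map_nil, List.prod_cons, List.prod_nil, mul_one] at hT
    have hl0 := muWord_cons_eq b x (i := j) (lam := P.root j)
      (rfl : muWord b x [] = 1) (by simp)
    have hl1 := muWord_cons_eq b x (i := i) (lam := P.root i + P.root j)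
      hl0 (by simpa [simpleRefl_inv, mul_smul] using b1)
    have hl2 := muWord_cons_eq b x (i := j) (lam := P.root i + P.root i + P.root j)
      hl1 (by simpa [simpleRefl_inv, mul_smul] using b2)
    have hl3 := muWord_cons_eq b x (i := i) (lam := P.root i)
      hl2 (by simpa [simpleRefl_inv, mul_smul] using b3)
    have hr0 := muWord_cons_eq b x (i := i) (lam := P.root i)
      (rfl : muWord b x [] = 1) (by simp)
    have hr1 := muWord_cons_eq b x (i := j) (lam := P.root i + P.root i + P.root j)
      hr0 (by simpa [simpleRefl_inv, mul_smul] using a1)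
    have hr2 := muWord_cons_eq b x (i := i) (lam := P.root i + P.root j)
      hr1 (by simpa [simpleRefl_inv, mul_smul] using a2)
    have hr3 := muWord_cons_eq b x (i := j) (lam := P.root j)
      hr2 (by simpa [simpleRefl_inv, mul_smul] using a3)
    rw [hl3, hr3]
    obtain ⟨n0, c0⟩ := cayley_spec x⁻¹ (v := 1) (k := i) i j 1 0
      (one_smul P.weylGroup (P.root i)) (by module)
    obtain ⟨n1, c1⟩ := cayley_spec x⁻¹ (v := simpleRefl b i) (k := j) i j 2 1
      a1 (by module)
    obtain ⟨n2, c2⟩ := cayley_spec x⁻¹ (v := simpleRefl b i * simpleRefl b j) (k := i) i j 1 1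
      (by simpa only [mul_smul] using a2) (by module)
    obtain ⟨n3, c3⟩ := cayley_spec x⁻¹ (v := simpleRefl b i * simpleRefl b j *
        simpleRefl b i) (k := j) i j 0 1
      (by simpa only [mul_smul] using a3) (by module)
    -- A word contributes its last letter first. For even length the word starting with `i` ends
    -- with `j`, so the sides are swapped.
    exact (yangBaxter_four_smul _ (Tsimple_mul_self b i) (Tsimple_mul_self b j) hT
      (cayley_relation_four n0 n1 n2 n3 c0 c1 c2 c3)).symm
  · refine Descends.len_eq ?_
    simp only [List.head?_cons, Option.mem_some_iff, forall_eq'] at h1 h2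
    rw [← neg_smul_root_mem_posCone_iff] at h1 h2
    simp only [Descends, mul_inv_rev, simpleRefl_inv, mul_smul, and_true]
    refine ⟨h1, ?_, ?_, ?_⟩
    · rw [a1]; simp only [smul_add, neg_add]
      repeat' first | assumption | apply add_mem
    · rw [a2]; simp only [smul_add, neg_add]
      repeat' first | assumption | apply add_mem
    · rw [a3]; exact h2

set_option maxHeartbeats 400000 in
lemma isBraid_six (hij : P.pairing i j = -1) (hji : P.pairing j i = -3) :
    IsBraid b [i, j, i, j, i, j] [j, i, j, i, j, i] := by
  have ni := simpleRefl_smul_self b i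
  have nj := simpleRefl_smul_self b j
  have a1 : simpleRefl b i • P.root j = P.root i + P.root i + P.root i + P.root j := by
    rw [simpleRefl_smul_root, hji]; module
  have b1 : simpleRefl b j • P.root i = P.root i + P.root j := by
    rw [simpleRefl_smul_root, hij]; module
  have a2 : simpleRefl b i • simpleRefl b j • P.root i = P.root i + P.root i + P.root j := by
    rw [b1]; simp only [smul_add, ni, a1]; abel
  have b2 : simpleRefl b j • simpleRefl b i • P.root j =
      P.root i + P.root i + P.root i + P.root j + P.root j := by
    rw [a1]; simp only [smul_add, nj, b1]; abel
  have a3 : simpleRefl b i • simpleRefl b j • simpleRefl b i • P.root j =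
      P.root i + P.root i + P.root i + P.root j + P.root j := by
    rw [b2]; simp only [smul_add, ni, a1]; abel
  have b3 : simpleRefl b j • simpleRefl b i • simpleRefl b j • P.root i =
      P.root i + P.root i + P.root j := by
    rw [a2]; simp only [smul_add, nj, b1]; abel
  have a4 : simpleRefl b i • simpleRefl b j • simpleRefl b i • simpleRefl b j • P.root i =
      P.root i + P.root j := by
    rw [b3]; simp only [smul_add, ni, a1]; abel
  have b4 : simpleRefl b j • simpleRefl b i • simpleRefl b j • simpleRefl b i • P.root j =
      P.root i + P.root i + P.root i + P.root j := by
    rw [a3]; simp only [smul_add, nj, b1]; abel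
  have a5 : simpleRefl b i • simpleRefl b j • simpleRefl b i • simpleRefl b j • simpleRefl b i •
      P.root j = P.root j := by
    rw [b4]; simp only [smul_add, ni, a1]; abel
  have b5 : simpleRefl b j • simpleRefl b i • simpleRefl b j • simpleRefl b i • simpleRefl b j •
      P.root i = P.root i := by
    rw [a4]; simp only [smul_add, nj, b1]; abel
  have hw : wordProd b [i, j, i, j, i, j] = wordProd b [j, i, j, i, j, i] := by
    simpa [mul_assoc] using simpleRefl_mul_eq_of_smul_root b
      (w := simpleRefl b j * simpleRefl b i * simpleRefl b j * simpleRefl b i * simpleRefl b j)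
          (Or.inl (by simp only [mul_smul]; exact b5))
  refine ⟨hw, rfl, fun hl x ↦ ?_, fun w h1 h2 ↦ ?_⟩
  · have hT := prod_Tsimple_eq b hw hl (by rw [← hw, hl]; rfl)
    simp only [List.map_cons, List.map_nil, List.prod_cons, List.prod_nil, mul_one] at hT
    have hl0 := muWord_cons_eq b x (i := j) (lam := P.root j)
      (rfl : muWord b x [] = 1) (by simp)
    have hl1 := muWord_cons_eq b x (i := i) (lam := P.root i + P.root j)
      hl0 (by simpa [simpleRefl_inv, mul_smul] using b1)
    have hl2 := muWord_cons_eq b x (i := j) (lam := P.root i + P.root i + P.root i + P.root j +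
        P.root j)
      hl1 (by simpa [simpleRefl_inv, mul_smul] using b2)
    have hl3 := muWord_cons_eq b x (i := i) (lam := P.root i + P.root i + P.root j)
      hl2 (by simpa [simpleRefl_inv, mul_smul] using b3)
    have hl4 := muWord_cons_eq b x (i := j) (lam := P.root i + P.root i + P.root i + P.root j)
      hl3 (by simpa [simpleRefl_inv, mul_smul] using b4)
    have hl5 := muWord_cons_eq b x (i := i) (lam := P.root i)
      hl4 (by simpa [simpleRefl_inv, mul_smul] using b5)
    have hr0 := muWord_cons_eq b x (i := i) (lam := P.root i)
      (rfl : muWord b x [] = 1) (by simp)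
    have hr1 := muWord_cons_eq b x (i := j) (lam := P.root i + P.root i + P.root i + P.root j)
      hr0 (by simpa [simpleRefl_inv, mul_smul] using a1)
    have hr2 := muWord_cons_eq b x (i := i) (lam := P.root i + P.root i + P.root j)
      hr1 (by simpa [simpleRefl_inv, mul_smul] using a2)
    have hr3 := muWord_cons_eq b x (i := j) (lam := P.root i + P.root i + P.root i + P.root j +
        P.root j)
      hr2 (by simpa [simpleRefl_inv, mul_smul] using a3)
    have hr4 := muWord_cons_eq b x (i := i) (lam := P.root i + P.root j)
      hr3 (by simpa [simpleRefl_inv, mul_smul] using a4)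
    have hr5 := muWord_cons_eq b x (i := j) (lam := P.root j)
      hr4 (by simpa [simpleRefl_inv, mul_smul] using a5)
    rw [hl5, hr5]
    obtain ⟨n0, c0⟩ := cayley_spec x⁻¹ (v := 1) (k := i) i j 1 0
      (one_smul P.weylGroup (P.root i)) (by module)
    obtain ⟨n1, c1⟩ := cayley_spec x⁻¹ (v := simpleRefl b i) (k := j) i j 3 1
      a1 (by module)
    obtain ⟨n2, c2⟩ := cayley_spec x⁻¹ (v := simpleRefl b i * simpleRefl b j) (k := i) i j 2 1
      (by simpa only [mul_smul] using a2) (by module)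
    obtain ⟨n3, c3⟩ := cayley_spec x⁻¹ (v := simpleRefl b i * simpleRefl b j *
        simpleRefl b i) (k := j) i j 3 2
      (by simpa only [mul_smul] using a3) (by module)
    obtain ⟨n4, c4⟩ := cayley_spec x⁻¹ (v := simpleRefl b i * simpleRefl b j * simpleRefl b i *
        simpleRefl b j) (k := i) i j 1 1
      (by simpa only [mul_smul] using a4) (by module)
    obtain ⟨n5, c5⟩ := cayley_spec x⁻¹ (v := simpleRefl b i * simpleRefl b j * simpleRefl b i *
        simpleRefl b j * simpleRefl b i) (k := j) i j 0 1
      (by simpa only [mul_smul] using a5) (by module)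
    obtain ⟨r1, r2, r3⟩ := cayley_relation_six n0 n1 n2 n3 n4 n5 c0 c1 c2 c3 c4 c5
    exact (yangBaxter_six_smul _ (Tsimple_mul_self b i) (Tsimple_mul_self b j) hT
      r1 r2 r3).symm
  · refine Descends.len_eq ?_
    simp only [List.head?_cons, Option.mem_some_iff, forall_eq'] at h1 h2
    rw [← neg_smul_root_mem_posCone_iff] at h1 h2
    simp only [Descends, mul_inv_rev, simpleRefl_inv, mul_smul, and_true]
    refine ⟨h1, ?_, ?_, ?_, ?_, ?_⟩
    · rw [a1]; simp only [smul_add, neg_add]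
      repeat' first | assumption | apply add_mem
    · rw [a2]; simp only [smul_add, neg_add]
      repeat' first | assumption | apply add_mem
    · rw [a3]; simp only [smul_add, neg_add]
      repeat' first | assumption | apply add_mem
    · rw [a4]; simp only [smul_add, neg_add]
      repeat' first | assumption | apply add_mem
    · rw [a5]; exact h2

end RankTwo

/-! ### Independence of the reduced word and the cocycle rule. -/

section WellDefined

variable {ι X Y : Type*} [Finite ι] [AddCommGroup X] [AddCommGroup Y] {P : RootDatum ι X Y}
  [P.IsReduced] (b : P.Base) [Module.Free ℤ X]

lemma exists_isBraid {i j : b.support} (hne : i ≠ j) :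
    ∃ ω ω' : List b.support, IsBraid b (i :: ω) (j :: ω') := by
  have hne' : (i : ι) ≠ j := fun h ↦ hne (Subtype.ext h)
  have e (k l : ι) : P.pairingIn ℤ k l = P.pairing k l := P.algebraMap_pairingIn ℤ k l
  have h1 := b.pairingIn_le_zero_of_ne hne' i.2 j.2
  have h2 := b.pairingIn_le_zero_of_ne hne'.symm j.2 i.2
  have h3 := P.pairingIn_pairingIn_mem_set_of_isCrystal_of_isRed' i j
    (fun h ↦ hne' (P.root.injective h)) (b.root_ne_neg_of_ne i.2 j.2 hne')
  rw [e, e] at h3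
  rw [e] at h1 h2
  simp only [Set.mem_insert_iff, Set.mem_singleton_iff, Prod.mk.injEq] at h3
  -- Of the possible pairs of pairings of two non-proportional roots, those with positive entries
  -- are excluded for distinct simple roots.
  rcases h3 with h | h | h | h | h | h | h | h | h | h | h
  · exact ⟨_, _, isBraid_two h.1 h.2⟩
  · omega
  · exact ⟨_, _, isBraid_three h.1 h.2⟩
  · omega
  · omega
  · exact ⟨_, _, isBraid_four h.1 h.2⟩
  · exact ⟨_, _, (isBraid_four h.2 h.1).symm⟩
  · omega
  · omega
  · exact ⟨_, _, isBraid_six h.1 h.2⟩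
  · exact ⟨_, _, (isBraid_six h.2 h.1).symm⟩

lemma muWord_append (x : P.weylGroup) (ω ω' : List b.support) :
    muWord b x (ω ++ ω') = muWord b x ω' * muWord b (wordProd b ω' * x) ω := by
  induction ω with
  | nil => simp [muWord]
  | cons i ω ih => rw [List.cons_append, muWord, ih, muWord, wordProd_append, mul_assoc, mul_assoc]

/-- The element `μ` computed along a reduced word depends only on the product of the word. -/
theorem muWord_eq_of_wordProd_eq {ω ω' : List b.support} (hω : len b (wordProd b ω) = ω.length)
    (hω' : len b (wordProd b ω') = ω'.length) (h : wordProd b ω = wordProd b ω')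
    (x : P.weylGroup) : muWord b x ω = muWord b x ω' := by
  induction hn : ω.length generalizing ω ω' with
  | zero =>
    rw [← h, hω, hn] at hω'
    rw [List.length_eq_zero_iff.1 hn, List.length_eq_zero_iff.1 hω'.symm]
  | succ n ih =>
    have hn' : ω'.length = n + 1 := by rw [← hω', ← h, hω, hn]
    obtain ⟨i, α, rfl⟩ := List.exists_cons_of_length_eq_add_one hn
    obtain ⟨j, β, rfl⟩ := List.exists_cons_of_length_eq_add_one hn'
    have htail : ∀ (k : b.support) (γ : List b.support),
        len b (wordProd b (k :: γ)) = (k :: γ).length → len b (wordProd b γ) = γ.length := by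
      intro k γ hγ
      have h1 := len_wordProd_le b γ
      have h2 := len_mul_le b (simpleRefl b k) (wordProd b γ)
      have h3 := len_simpleRefl_le b k
      rw [wordProd_cons, List.length_cons] at hγ
      omega
    have hdesc : ∀ (k : b.support) (γ : List b.support),
        len b (wordProd b (k :: γ)) = (k :: γ).length →
          (wordProd b (k :: γ))⁻¹ • P.root k ∉ posCone b := by
      intro k γ hγ
      have := htail k γ hγ
      rw [← len_lt_simpleRefl_mul_iff, hγ, wordProd_cons, simpleRefl_mul_cancel_left,
        List.length_cons]
      omega
    by_cases hij : i = j
    · subst hij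
      have hp : wordProd b α = wordProd b β := by simpa using h
      rw [muWord, muWord, hp, ih (htail _ _ hω) (htail _ _ hω') hp (by simpa using hn)]
    -- Both `i` and `j` are left descents, so the rank-two longest element splits off with a reduced
    -- remainder `γ`. Then pass from `i :: α` to `i :: (L ++ γ)` to `j :: (L' ++ γ)` to `j :: β`:
    -- the outer steps share a first letter and use induction, the middle one is the braid relation.
    · obtain ⟨L, L', hb⟩ := exists_isBraid b hij
      have hd := hb.descends (wordProd b (i :: α))
        (by simpa using hdesc _ _ hω) (by rw [h]; simpa using hdesc _ _ hω')
      obtain ⟨γ, hγ, hγw⟩ := exists_reduced b ((wordProd b (i :: L))⁻¹ * wordProd b (i :: α))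
      have hred : len b (wordProd b (i :: L)) = (i :: L).length := by
        have h1 := len_mul_le b (wordProd b (i :: L))
          ((wordProd b (i :: L))⁻¹ * wordProd b (i :: α))
        rw [mul_inv_cancel_left] at h1
        have h2 := len_wordProd_le b (i :: L)
        omega
      have hlen : (L ++ γ).length = n := by
        rw [hω, hn, ← hγ, List.length_cons] at hd
        rw [List.length_append]
        omega
      have hlen' : (L' ++ γ).length = n := by
        have := hb.length_eq
        simp only [List.length_cons, List.length_append] at this hlen ⊢
        omega
      have hprod : wordProd b (i :: (L ++ γ)) = wordProd b (i :: α) := by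
        rw [← List.cons_append, wordProd_append, hγw, mul_inv_cancel_left]
      have hprod' : wordProd b (j :: (L' ++ γ)) = wordProd b (j :: β) := by
        rw [← h, ← hprod, ← List.cons_append, ← List.cons_append, wordProd_append,
          wordProd_append, hb.wordProd_eq]
      have key : ∀ (k : b.support) (M δ : List b.support), δ.length = n → M.length = n →
          len b (wordProd b (k :: δ)) = (k :: δ).length →
          wordProd b (k :: M) = wordProd b (k :: δ) →
          muWord b x (k :: δ) = muWord b x (k :: M) := by
        intro k M δ hδ hM hkδ hkM
        have hp : wordProd b δ = wordProd b M := by simpa using hkM.symm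
        have hM' : len b (wordProd b M) = M.length := by
          rw [← hp, htail _ _ hkδ, hδ, hM]
        rw [muWord, muWord, hp, ih (htail _ _ hkδ) hM' hp hδ]
      rw [key i (L ++ γ) α (by simpa using hn) hlen hω hprod,
        key j (L' ++ γ) β (by simpa using hn') hlen' hω' hprod',
        ← List.cons_append, ← List.cons_append, muWord_append, muWord_append,
        hb.muWord_eq hred]

lemma mu_eq_muWord {ω : List b.support} (hω : len b (wordProd b ω) = ω.length)
    (x : P.weylGroup) : mu b x (wordProd b ω) = muWord b x ω :=
  muWord_eq_of_wordProd_eq b (by rw [wordProd_redWord, redWord_length]) hω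
    (wordProd_redWord b _) x

theorem mu_mul (x : P.weylGroup) {v w : P.weylGroup} (h : len b (v * w) = len b v + len b w) :
    mu b x (v * w) = mu b x w * mu b (w * x) v := by
  have hp : wordProd b (redWord b v ++ redWord b w) = v * w := by
    rw [wordProd_append, wordProd_redWord, wordProd_redWord]
  have := mu_eq_muWord b (ω := redWord b v ++ redWord b w)
    (by rw [hp, List.length_append, redWord_length, redWord_length, h]) x
  rw [hp] at this
  rw [this, muWord_append, wordProd_redWord, mu, mu]

lemma mu_simpleRefl_mul (x : P.weylGroup) {i : b.support} {w : P.weylGroup}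
    (h : len b w < len b (simpleRefl b i * w)) :
    mu b x (simpleRefl b i * w) = mu b x w * muSimple b (w * x) i := by
  have h1 := len_simpleRefl_mul_or b i w
  have hp : wordProd b (i :: redWord b w) = simpleRefl b i * w := by
    rw [wordProd_cons, wordProd_redWord]
  have := mu_eq_muWord b (ω := i :: redWord b w)
    (by rw [hp, List.length_cons, redWord_length]; omega) x
  rw [hp] at this
  rw [this, muWord, wordProd_redWord, mu]

end WellDefined

/-! ### The bar automorphism is an involution. -/

section Coefficients

variable {X : Type*} [AddCommGroup X]

lemma bar_bar (f : FunField X) : bar (bar f) = f := by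
  have : (bar (X := X)).toRingHom.comp (bar (X := X)).toRingHom = RingHom.id (FunField X) := by
    refine IsLocalization.ringHom_ext (nonZeroDivisors (CoordRing X)) ?_
    refine RingHom.ext fun a ↦ ?_
    simp only [bar, RingHom.comp_apply, RingEquiv.toRingHom_eq_coe, RingEquiv.coe_toRingHom,
      RingHom.id_apply, IsFractionRing.ringEquivOfRingEquiv_algebraMap]
    congr 1
    induction a using AddMonoidAlgebra.induction_linear with
    | zero => simp
    | add f g hf hg => simp only [map_add, hf, hg]
    | single m c =>
      obtain ⟨n, lam⟩ := m
      simp [AddEquiv.prodCongr]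
  exact RingHom.congr_fun this f

end Coefficients

/-! ### Leading terms of `μ` and invertibility of `r`. -/

section Triangularity

variable {ι X Y : Type*} [Finite ι] [AddCommGroup X] [AddCommGroup Y] {P : RootDatum ι X Y}
  [P.IsReduced] (b : P.Base)

lemma len_mul_simpleRefl_or (w : P.weylGroup) (i : b.support) :
    len b (w * simpleRefl b i) = len b w + 1 ∨ len b (w * simpleRefl b i) + 1 = len b w := by
  have := len_simpleRefl_mul_or b i w⁻¹
  rwa [len_inv, ← len_mul_simpleRefl] at this

lemma heckeOpRight_mem_supported {i : b.support} {n : ℕ} {f : P.weylGroup →₀ FunField X}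
    (hf : f ∈ Finsupp.supported (FunField X) (FunField X) {w | len b w < n}) :
    heckeOpRight b i f ∈ Finsupp.supported (FunField X) (FunField X) {w | len b w < n + 1} := by
  have hle : Finsupp.supported (FunField X) (FunField X) {w | len b w < n} ≤
      (Finsupp.supported (FunField X) (FunField X) {w | len b w < n + 1}).comap
        (heckeOpRight b i) := by
    rw [Finsupp.supported_eq_span_single (R := FunField X) (s := {w | len b w < n}),
        Submodule.span_le]
    rintro - ⟨w, hw, rfl⟩
    have hw' : len b w < n := hw
    have h1 := len_mul_simpleRefl_or b w i
    rw [SetLike.mem_coe, Submodule.mem_comap]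
    by_cases h : len b w < len b (w * simpleRefl b i)
    · rw [heckeOpRight_single_of_lt b _ h]
      exact Finsupp.single_mem_supported _ _ (by rw [Set.mem_ofPred_eq]; omega)
    · rw [heckeOpRight_single_of_not_lt b _ h]
      exact add_mem (Finsupp.single_mem_supported _ _ (by rw [Set.mem_ofPred_eq]; omega))
        (Finsupp.single_mem_supported _ _ (by rw [Set.mem_ofPred_eq]; omega))
  exact hle hf

variable [Module.Free ℤ X]

/-- Along a reduced word of `w`, the element `μ` is `q ^ (-l(w)) T_{w⁻¹}` plus a combination of
`T_y` with `l(y) < l(w)`. -/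
lemma muWord_apply_one (x : P.weylGroup) {ω : List b.support}
    (hω : len b (wordProd b ω) = ω.length) :
    ∃ f ∈ Finsupp.supported (FunField X) (FunField X) {w : P.weylGroup | len b w < ω.length},
      (muWord b x ω).1 (Finsupp.single 1 1) =
        Finsupp.single (wordProd b ω)⁻¹ ((qv : FunField X)⁻¹ ^ ω.length) + f := by
  induction ω with
  | nil => exact ⟨0, zero_mem _, by simp [muWord]⟩
  | cons i ω ih =>
    have h1 := len_wordProd_le b ω
    have h2 := len_simpleRefl_mul_or b i (wordProd b ω)
    rw [wordProd_cons, List.length_cons] at hω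
    obtain ⟨f, hf, he⟩ := ih (by omega)
    -- The scalar part only contributes shorter terms, so its value is irrelevant here.
    obtain ⟨c, hc⟩ : ∃ c, muSimple b (wordProd b ω * x) i = (qv : FunField X)⁻¹ • Tsimple b i +
        algebraMap (FunField X) (HeckeAlg b) c := ⟨_, rfl⟩
    have hlt : len b (wordProd b ω)⁻¹ < len b ((wordProd b ω)⁻¹ * simpleRefl b i) := by
      rw [len_mul_simpleRefl, inv_inv, len_inv]; omega
    have hmono : Finsupp.supported (FunField X) (FunField X) {w : P.weylGroup | len b w < ω.length}
        ≤ Finsupp.supported (FunField X) (FunField X) {w | len b w < ω.length + 1} :=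
      Finsupp.supported_mono (by
        intro w hw
        rw [Set.mem_ofPred_eq] at hw ⊢
        omega)
    refine ⟨(qv : FunField X)⁻¹ • heckeOpRight b i f +
      c • (Finsupp.single (wordProd b ω)⁻¹ ((qv : FunField X)⁻¹ ^ ω.length) + f), ?_, ?_⟩
    · rw [List.length_cons]
      refine add_mem (Submodule.smul_mem _ _ (heckeOpRight_mem_supported b hf))
        (Submodule.smul_mem _ _ (add_mem (Finsupp.single_mem_supported _ _ ?_) (hmono hf)))
      rw [Set.mem_ofPred_eq, len_inv]
      omega
    · have hm : (muWord b x (i :: ω)).1 (Finsupp.single 1 1) =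
          (qv : FunField X)⁻¹ • heckeOpRight b i ((muWord b x ω).1 (Finsupp.single 1 1)) +
            c • (muWord b x ω).1 (Finsupp.single 1 1) := by
        rw [← mul_Tsimple_apply_one, muWord, hc, mul_add, mul_smul_comm, ← Algebra.commutes,
          ← Algebra.smul_def]
        rfl
      rw [hm, he, map_add, heckeOpRight_single_of_lt b _ hlt, smul_add, Finsupp.smul_single,
        wordProd_cons, mul_inv_rev, simpleRefl_inv, List.length_cons, pow_succ', smul_eq_mul,
        add_assoc]

lemma heckeCoeff_mu_self (x w : P.weylGroup) :
    heckeCoeff b (mu b x w) w⁻¹ = (qv : FunField X)⁻¹ ^ len b w := by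
  obtain ⟨f, hf, he⟩ := muWord_apply_one b x (ω := redWord b w)
    (by rw [wordProd_redWord, redWord_length])
  rw [wordProd_redWord, redWord_length] at he
  rw [redWord_length] at hf
  have h0 : f w⁻¹ = 0 := by
    by_contra h
    have := hf (Finsupp.mem_support_iff.2 h)
    rw [Set.mem_ofPred_eq, len_inv] at this
    omega
  rw [heckeCoeff, mu, he, Finsupp.add_apply, h0, Finsupp.single_eq_same, add_zero]

lemma heckeCoeff_mu_eq_zero (x : P.weylGroup) {w y : P.weylGroup} (hy : len b w ≤ len b y)
    (hne : y ≠ w⁻¹) : heckeCoeff b (mu b x w) y = 0 := by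
  obtain ⟨f, hf, he⟩ := muWord_apply_one b x (ω := redWord b w)
    (by rw [wordProd_redWord, redWord_length])
  rw [wordProd_redWord, redWord_length] at he
  rw [redWord_length] at hf
  have h0 : f y = 0 := by
    by_contra h
    have := hf (Finsupp.mem_support_iff.2 h)
    rw [Set.mem_ofPred_eq] at this
    omega
  rw [heckeCoeff, mu, he, Finsupp.add_apply, h0, Finsupp.single_eq_of_ne hne, add_zero]

lemma bar_r (u v : P.weylGroup) :
    bar (r b u v) = qv ^ len b u * heckeCoeff b (mu b 1 v) u⁻¹ := by
  rw [r, Matrix.of_apply, bar_bar]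

lemma r_blockTriangular : (r b).BlockTriangular (len b) := by
  intro u v h
  rw [r, Matrix.of_apply, heckeCoeff_mu_eq_zero b 1 (by rw [len_inv]; omega), mul_zero, map_zero]
  rintro h'
  rw [inv_inj.1 h'] at h
  exact lt_irrefl _ h

lemma r_self (u : P.weylGroup) : r b u u = 1 := by
  rw [r, Matrix.of_apply, heckeCoeff_mu_self, ← mul_pow, mul_inv_cancel₀ qv_ne_zero, one_pow,
    map_one]

lemma r_of_len_eq {u v : P.weylGroup} (h : len b u = len b v) (hne : u ≠ v) : r b u v = 0 := by
  rw [r, Matrix.of_apply, heckeCoeff_mu_eq_zero b 1 (by rw [len_inv]; omega), mul_zero, map_zero]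
  exact fun h' ↦ hne (inv_inj.1 h')

/-- Ordering by length is enough, without the Bruhat order: the blocks of equal length on the
diagonal are identity matrices. -/
lemma det_r : (r b).det = 1 := by
  rw [(r_blockTriangular b).det]
  refine Finset.prod_eq_one fun k _ ↦ ?_
  suffices (r b).toSquareBlock (len b) k = 1 by rw [this, Matrix.det_one]
  ext u v
  rw [Matrix.toSquareBlock_def, Matrix.of_apply, Matrix.one_apply]
  split_ifs with h
  · rw [h, r_self]
  · exact r_of_len_eq b (u.2.trans v.2.symm) fun e ↦ h (Subtype.ext e)

lemma r_mul_rInv : r b * rInv b = 1 :=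
  Matrix.mul_nonsing_inv _ (by rw [det_r]; exact isUnit_one)

lemma rInv_mul_r : rInv b * r b = 1 :=
  Matrix.nonsing_inv_mul _ (by rw [det_r]; exact isUnit_one)

lemma mu_eq_sum_bar_r (v : P.weylGroup) :
    mu b 1 v = ∑ u : P.weylGroup,
      ((qv : FunField X) ^ len b u)⁻¹ • bar (r b u v) • T b u⁻¹ := by
  rw [eq_sum_heckeCoeff b (mu b 1 v), ← Equiv.sum_comp (Equiv.inv P.weylGroup)]
  refine Finset.sum_congr rfl fun u _ ↦ ?_
  rw [bar_r, smul_smul, inv_mul_cancel_left₀ (pow_ne_zero _ qv_ne_zero)]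
  rfl

end Triangularity

/-! ### Passing from ascents to descents by the quadratic relation. -/

section QuadraticRelation

variable {K A : Type*} [CommRing K] [Semiring A] [Algebra K A]

lemma mul_eq_of_eq_mul_smul_add {p q c : K} {M N S : A} (hq : p * q = 1)
    (h : N = M * p • (S + algebraMap K A c)) : M * S = (-c) • M + q • N := by
  rw [h, mul_smul_comm, mul_add, ← Algebra.commutes, ← Algebra.smul_def, smul_smul, mul_comm q,
    hq]
  module

/-- Solve the ascent relation for `N` and multiply by `S` once more. The value `-(1 + c)` is what
`c` becomes when the root changes sign, so the coefficient of `N` keeps the shape it had for `M`. -/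
lemma mul_eq_of_quadratic {p q c : K} {M N S : A} (hq : p * q = 1)
    (hS : S * S = (q - 1) • S + algebraMap K A q) (h : M * S = (-((q - 1) * c)) • M + q • N) :
    N * S = (-((q - 1) * -(1 + c))) • N + (1 - p * (q - 1) * ((1 + c) * ((q - 1) * c))) • M := by
  have hN : N = p • (M * S) + (p * ((q - 1) * c)) • M := by
    rw [h]
    match_scalars
    · linear_combination -hq
    · ring
  have hMSS : M * S * S = (q - 1) • (M * S) + q • M := by
    rw [mul_assoc, hS, mul_add, mul_smul_comm, ← Algebra.commutes, ← Algebra.smul_def]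
  have e : N * S = (p * (q - 1) * (1 + c)) • (M * S) + (p * q) • M := by
    nth_rewrite 1 [hN]
    rw [add_mul, smul_mul_assoc, smul_mul_assoc, hMSS]
    module
  rw [e, h]
  match_scalars
  · linear_combination hq
  · linear_combination (q - 1) * (1 + c) * hq

end QuadraticRelation

/-! ### The recursion for the inverse matrix. -/

section Recursion

variable {ι X Y : Type*} [Finite ι] [AddCommGroup X] [AddCommGroup Y] {P : RootDatum ι X Y}
  [P.IsReduced] (b : P.Base) [Module.Free ℤ X]

/-- The normalised basis element `q ^ (-l(v)) T_{v⁻¹}`. -/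
noncomputable def normT (v : P.weylGroup) : HeckeAlg b :=
  ((qv : FunField X) ^ len b v)⁻¹ • T b v⁻¹

/-- The coordinate of an element of the Hecke algebra along `μ_z(w)`, in the basis of the
`μ_z(v)`. -/
noncomputable def muCoeff (w : P.weylGroup) : HeckeAlg b →ₗ[FunField X] FunField X where
  toFun h := ∑ u, bar (rInv b w u) * (qv ^ len b u * heckeCoeff b h u⁻¹)
  map_add' h h' := by
    rw [← Finset.sum_add_distrib]
    refine Finset.sum_congr rfl fun u _ ↦ ?_
    change _ * (_ * (heckeCoeff b h _ + heckeCoeff b h' _)) = _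
    ring
  map_smul' c h := by
    rw [RingHom.id_apply, smul_eq_mul, Finset.mul_sum]
    refine Finset.sum_congr rfl fun u _ ↦ ?_
    change _ * (_ * (c * heckeCoeff b h _)) = _
    ring

lemma muCoeff_mu (w v : P.weylGroup) : muCoeff b w (mu b 1 v) = if w = v then 1 else 0 := by
  have h := congrArg bar (congrFun (congrFun (rInv_mul_r b) w) v)
  rw [Matrix.mul_apply, map_sum, Matrix.one_apply] at h
  change ∑ u, _ = _
  simp only [map_mul, bar_r] at h
  rw [h]
  split_ifs <;> simp

lemma normT_eq_sum_mu (v : P.weylGroup) :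
    normT b v = ∑ w : P.weylGroup, bar (rInv b w v) • mu b 1 w := by
  simp only [mu_eq_sum_bar_r, Finset.smul_sum]
  rw [Finset.sum_comm]
  have h (u : P.weylGroup) := congrArg bar (congrFun (congrFun (r_mul_rInv b) u) v)
  simp only [Matrix.mul_apply, map_sum, map_mul, Matrix.one_apply] at h
  have h' (u : P.weylGroup) : ∑ w : P.weylGroup, bar (rInv b w v) •
      ((qv : FunField X) ^ len b u)⁻¹ • bar (r b u w) • T b u⁻¹ =
      bar (if u = v then (1 : FunField X) else 0) • normT b u := by
    rw [← h, Finset.sum_smul]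
    refine Finset.sum_congr rfl fun w _ ↦ ?_
    rw [normT, smul_smul, smul_smul, smul_smul]
    congr 1
    ring
  rw [Finset.sum_congr rfl fun u _ ↦ h' u, Finset.sum_eq_single v]
  · simp
  · intro u _ hu
    simp [hu]
  · simp

-- Replacing `t` by `t⁻¹` turns `t / (1 - t)` into `-1 / (1 - t)`.
omit [Finite ι] [P.IsReduced] in
lemma cayley_neg_smul_root (w : P.weylGroup) (k : ι) :
    cayley (-(w • P.root k)) = -(1 + cayley (w • P.root k)) := by
  have h0 := one_sub_zpow_smul_root_ne_zero w k
  have h1 : zpow (w • P.root k) * zpow (-(w • P.root k)) = 1 := by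
    rw [← zpow_add, add_neg_cancel, zpow]
    exact map_one _
  have h2 : zpow (w • P.root k) ≠ 0 := left_ne_zero_of_mul_eq_one h1
  rw [cayley, cayley, eq_inv_of_mul_eq_one_right h1]
  have h3 : zpow (w • P.root k) - 1 ≠ 0 := by rwa [← neg_ne_zero, neg_sub]
  field_simp
  ring

lemma mu_mul_Tsimple_of_lt {i : b.support} {w : P.weylGroup}
    (h : len b w < len b (simpleRefl b i * w)) :
    mu b 1 w * Tsimple b i = (-((qv - 1) * cayley (w⁻¹ • P.root i)) : FunField X) • mu b 1 w +
      (qv : FunField X) • mu b 1 (simpleRefl b i * w) := by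
  refine mul_eq_of_eq_mul_smul_add (inv_mul_cancel₀ qv_ne_zero) ?_
  rw [mu_simpleRefl_mul b 1 h, muSimple_eq, mul_one]

/-- The diagonal coefficient has one formula for ascents and descents; the other one is needed only
for ascents and is left implicit for descents. -/
lemma mu_mul_Tsimple (i : b.support) (w : P.weylGroup) :
    ∃ c : FunField X, (len b w < len b (simpleRefl b i * w) → c = qv) ∧
      mu b 1 w * Tsimple b i =
        (-((qv - 1) * cayley (w⁻¹ • P.root i)) : FunField X) • mu b 1 w +
          c • mu b 1 (simpleRefl b i * w) := by
  by_cases h : len b w < len b (simpleRefl b i * w)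
  · exact ⟨qv, fun _ ↦ rfl, mu_mul_Tsimple_of_lt b h⟩
  obtain ⟨v, rfl⟩ : ∃ v, w = simpleRefl b i * v := ⟨simpleRefl b i * w, by simp⟩
  have h' : len b v < len b (simpleRefl b i * v) := by
    have := len_simpleRefl_mul_or b i v
    rw [simpleRefl_mul_cancel_left] at h
    omega
  have hv := mu_mul_Tsimple_of_lt b h'
  have hq := qv_ne_zero (X := X)
  have hc : cayley ((simpleRefl b i * v)⁻¹ • P.root i) = -(1 + cayley (v⁻¹ • P.root i)) := by
    rw [mul_inv_rev, simpleRefl_inv, mul_smul, simpleRefl_smul_self, smul_neg,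
      cayley_neg_smul_root]
  have key := mul_eq_of_quadratic (inv_mul_cancel₀ hq) (Tsimple_mul_self b i) hv
  rw [← hc] at key
  exact ⟨_, fun hn ↦ absurd hn h, by rwa [simpleRefl_mul_cancel_left]⟩

lemma normT_mul_Tsimple_of_lt {i : b.support} {v : P.weylGroup}
    (h : len b v < len b (simpleRefl b i * v)) :
    normT b v * Tsimple b i = (qv : FunField X) • normT b (simpleRefl b i * v) := by
  have h1 := len_simpleRefl_mul_or b i v
  have hl : len b (simpleRefl b i * v) = len b v + 1 := by omega
  have hq := qv_ne_zero (X := X)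
  have hT : T b v⁻¹ * Tsimple b i = T b (simpleRefl b i * v)⁻¹ := by
    refine heckeAlg_ext b ?_
    rw [mul_Tsimple_apply_one, T_apply_one, T_apply_one, heckeOpRight_single_of_lt, mul_inv_rev,
      simpleRefl_inv]
    rwa [len_mul_simpleRefl, inv_inv, len_inv]
  rw [normT, normT, smul_mul_assoc, hT, smul_smul, hl, pow_succ, mul_inv, mul_left_comm,
    mul_inv_cancel₀ hq, mul_one]

lemma normT_mul_Tsimple_of_gt {i : b.support} {v : P.weylGroup}
    (h : len b (simpleRefl b i * v) < len b v) :
    normT b v * Tsimple b i = (qv - 1 : FunField X) • normT b v +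
      normT b (simpleRefl b i * v) := by
  have h1 := len_simpleRefl_mul_or b i v
  have hl : len b v = len b (simpleRefl b i * v) + 1 := by omega
  have hq := qv_ne_zero (X := X)
  have hT : T b v⁻¹ * Tsimple b i = (qv - 1 : FunField X) • T b v⁻¹ +
      (qv : FunField X) • T b (simpleRefl b i * v)⁻¹ := by
    refine heckeAlg_ext b ?_
    rw [mul_Tsimple_apply_one]
    change _ = (qv - 1 : FunField X) • (T b v⁻¹).1 _ + (qv : FunField X) • (T b _).1 _
    rw [T_apply_one, T_apply_one, heckeOpRight_single_of_not_lt, mul_inv_rev,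
      simpleRefl_inv]
    · simp only [Finsupp.smul_single, smul_eq_mul, one_mul, mul_one]
    · rw [len_mul_simpleRefl, inv_inv, len_inv]
      omega
  rw [normT, normT, smul_mul_assoc, hT, smul_add, smul_smul, smul_smul, smul_smul, hl, pow_succ,
    mul_inv, inv_mul_cancel_right₀ hq, mul_comm (qv - 1 : FunField X)]

/-- Comparison of coordinates along `μ_z(su)` after right multiplication by `T_s`. -/
lemma muCoeff_normT_mul_Tsimple {i : b.support} {u : P.weylGroup} (v : P.weylGroup)
    (h : len b u < len b (simpleRefl b i * u)) :
    muCoeff b (simpleRefl b i * u) (normT b v * Tsimple b i) =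
      bar (rInv b (simpleRefl b i * u) v) * ((qv - 1) * (1 + cayley (u⁻¹ • P.root i))) +
        bar (rInv b u v) * qv := by
  choose c hc hmu using mu_mul_Tsimple b i
  have hne : u ≠ simpleRefl b i * u := fun e ↦ by rw [← e] at h; exact lt_irrefl _ h
  have hcay : cayley ((simpleRefl b i * u)⁻¹ • P.root i) = -(1 + cayley (u⁻¹ • P.root i)) := by
    rw [mul_inv_rev, simpleRefl_inv, mul_smul, simpleRefl_smul_self, smul_neg,
      cayley_neg_smul_root]
  rw [normT_eq_sum_mu, Finset.sum_mul, map_sum]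
  -- Only `w = su` (diagonal term) and `w = u` (off-diagonal term, with coefficient `q` as `su > u`)
  -- contribute to `μ_z(su)`.
  simp only [smul_mul_assoc, hmu, map_smul, map_add, muCoeff_mu, mul_right_inj, smul_eq_mul,
    mul_ite, mul_one, mul_zero]
  simp only [mul_add, Finset.sum_add_distrib, mul_ite, mul_zero, Finset.sum_ite_eq,
    Finset.mem_univ, if_true, hcay, hc u h]
  ring

lemma muCoeff_normT (w v : P.weylGroup) : muCoeff b w (normT b v) = bar (rInv b w v) := by
  rw [normT_eq_sum_mu, map_sum]
  simp [muCoeff_mu]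

lemma bar_cayley (lam : X) : bar (cayley lam) = cayley lam := by
  rw [cayley, map_div₀, map_sub, map_one, bar_zpow]

lemma rInv_of_lt {i : b.support} {u v : P.weylGroup} (hu : len b u < len b (simpleRefl b i * u))
    (hv : len b v < len b (simpleRefl b i * v)) :
    rInv b u v = rInv b (simpleRefl b i * u) (simpleRefl b i * v) +
      (qv - 1) / (1 - zpow (u⁻¹ • P.root i)) * rInv b (simpleRefl b i * u) v := by
  have h := muCoeff_normT_mul_Tsimple b v hu
  rw [normT_mul_Tsimple_of_lt b hv, map_smul, muCoeff_normT, smul_eq_mul] at h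
  -- Barring removes the bars on `r'` and inverts `q`; the factor `1 + c(u⁻¹α)` is `1 / (1 -
  -- z^{u⁻¹α})`.
  have h' := congrArg bar h
  simp only [map_mul, map_add, map_sub, map_one, bar_bar, bar_qv, bar_cayley] at h'
  have hq := qv_ne_zero (X := X)
  have hz := one_sub_zpow_smul_root_ne_zero u⁻¹ i
  rw [cayley] at h'
  field_simp at h' ⊢
  linear_combination -h'

lemma rInv_of_gt {i : b.support} {u v : P.weylGroup} (hu : len b u < len b (simpleRefl b i * u))
    (hv : len b (simpleRefl b i * v) < len b v) :
    rInv b u v = (qv - 1) * zpow (u⁻¹ • P.root i) / (1 - zpow (u⁻¹ • P.root i)) *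
        rInv b (simpleRefl b i * u) v +
      qv * rInv b (simpleRefl b i * u) (simpleRefl b i * v) := by
  have h := muCoeff_normT_mul_Tsimple b v hu
  rw [normT_mul_Tsimple_of_gt b hv, map_add, map_smul, muCoeff_normT, muCoeff_normT,
    smul_eq_mul] at h
  -- The extra diagonal term `q - 1` of the descent rule cancels the `1` in `1 + c(u⁻¹α)`, leaving
  -- `z^{u⁻¹α}` in the numerator.
  have h' := congrArg bar h
  simp only [map_mul, map_add, map_sub, map_one, bar_bar, bar_qv, bar_cayley] at h'
  have hq := qv_ne_zero (X := X)
  have hz := one_sub_zpow_smul_root_ne_zero u⁻¹ i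
  rw [cayley] at h'
  field_simp at h' ⊢
  linear_combination -h'

-- The recursion uses the Bruhat hypotheses only through lengths, which increase along each step of
-- a chain.
omit [Module.Free ℤ X] in
lemma len_lt_of_bruhatLT {u v : P.weylGroup} (h : BruhatLT b u v) : len b u < len b v := by
  obtain ⟨h, hne⟩ := h
  have key : ∀ w, BruhatLE b u w → u = w ∨ len b u < len b w := by
    intro w hw
    induction hw with
    | refl => exact Or.inl rfl
    | tail _ hs ih =>
      rcases ih with rfl | ih
      · exact Or.inr hs.2
      · exact Or.inr (ih.trans hs.2)
  exact (key v h).resolve_left hne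

end Recursion

end Casselman

theorem mainTheorem9 {ι X Y : Type*} [Finite ι] [AddCommGroup X] [AddCommGroup Y]
    [Module.Free ℤ X] [Module.Finite ℤ X] (P : RootDatum ι X Y) [P.IsReduced] (b : P.Base) :
    -- the elements `μ` are well defined: they satisfy the cocycle relation
    (∀ x w₁ w₂ : P.weylGroup,
      Casselman.len b (w₁ * w₂) = Casselman.len b w₁ + Casselman.len b w₂ →
      Casselman.mu b x (w₁ * w₂) = Casselman.mu b x w₂ * Casselman.mu b (w₂ * x) w₁) ∧
    -- the matrix `r` is the matrix of coefficients of the `μ_z(v)` in the basis `T`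
    (∀ v : P.weylGroup, Casselman.mu b 1 v = ∑ u : P.weylGroup,
      ((Casselman.qv : Casselman.FunField X) ^ Casselman.len b u)⁻¹ •
        Casselman.bar (Casselman.r b u v) • Casselman.T b u⁻¹) ∧
    -- the matrix `r` is invertible, with inverse `r'`
    (Casselman.r b * Casselman.rInv b = 1 ∧ Casselman.rInv b * Casselman.r b = 1) ∧
    -- the recursion
    (∀ (i : b.support) (u v : P.weylGroup),
      Casselman.BruhatLT b u (Casselman.simpleRefl b i * u) →
      (Casselman.BruhatLT b v (Casselman.simpleRefl b i * v) →
        Casselman.rInv b u v =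
          Casselman.rInv b (Casselman.simpleRefl b i * u) (Casselman.simpleRefl b i * v) +
          (Casselman.qv - 1) / (1 - Casselman.zpow (u⁻¹ • P.root i)) *
            Casselman.rInv b (Casselman.simpleRefl b i * u) v) ∧
      (Casselman.BruhatLT b (Casselman.simpleRefl b i * v) v →
        Casselman.rInv b u v =
          (Casselman.qv - 1) * Casselman.zpow (u⁻¹ • P.root i) /
              (1 - Casselman.zpow (u⁻¹ • P.root i)) *
            Casselman.rInv b (Casselman.simpleRefl b i * u) v +
          Casselman.qv *
            Casselman.rInv b (Casselman.simpleRefl b i * u) (Casselman.simpleRefl b i * v))) := by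
  refine ⟨fun x v w h ↦ Casselman.mu_mul b x h, Casselman.mu_eq_sum_bar_r b,
    ⟨Casselman.r_mul_rInv b, Casselman.rInv_mul_r b⟩, fun i u v hu ↦ ⟨fun hv ↦ ?_, fun hv ↦ ?_⟩⟩
  · exact Casselman.rInv_of_lt b (Casselman.len_lt_of_bruhatLT b hu)
      (Casselman.len_lt_of_bruhatLT b hv)
  · exact Casselman.rInv_of_gt b (Casselman.len_lt_of_bruhatLT b hu)
      (Casselman.len_lt_of_bruhatLT b hv)
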